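/- Let $G$ be a group with a Garside structure $(G^+,\Delta)$: $G^+$ is a submonoid of $G$ with $G^+\cap (G^+)^{-1}=\{1\}$, $\Delta\in G^+$, the prefix order ($x\preccurlyeq y$ iff $x^{-1}y\in G^+$) and the suffix order ($x\succcurlyeq y$ iff $xy^{-1}\in G^+$) are lattice orders on $G$, the set of simple elements $\mathcal D=\{s\in G^+ : s\preccurlyeq\Delta\}=\{s\in G^+ : \Delta\succcurlyeq s\}$ generates $G^+$ as a monoid and $G$ as a group, and for every $x\in G^+\setminus\{1\}$ the number of factors in decompositions of $x$ into non-trivial positive elements is bounded. Assume that $G$ is of finite type, i.e. $\mathcal D$ is finite. A simple element is proper if it is different from $1$ and $\Delta$. Write $\inf(g)=\max\{r\in\mathbb Z:\Delta^r\preccurlyeq g\}$, $\sup(g)=\min\{s\in\mathbb Z: g\preccurlyeq\Delta^s\}$, $\ell(g)=\sup(g)-\inf(g)$ and $\underline g=g\Delta^{-\inf(g)}$. Let $\mathcal X$ be the graph whose vertices are the left cosets $g\langle\Delta\rangle$, with an edge between $g\langle\Delta\rangle$ and $h\langle\Delta\rangle$ whenever $\underline g\,s\in h\langle\Delta\rangle$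 for some proper simple element $s$, and let $d_{\mathcal X}$ be its graph metric, also written $d_{\mathcal X}(g,h)$ for $d_{\mathcal X}(g\langle\Delta\rangle,h\langle\Delta\rangle)$. The left normal form of $g$ is its decomposition $g=\Delta^{\inf(g)}s_1\cdots s_r$ into proper simple elements with $(s_i^{-1}\Delta)\wedge s_{i+1}=1$ for all $i<r$ (greatest common prefix); the right normal form is $g=s'_r\cdots s'_1\Delta^{\inf(g)}$ where the greatest common suffix of $\Delta s_i'^{-1}$ and $s'_{i+1}$ is $1$ for all $i<r$. The preferred path $A(g,h)$ in $\mathcal X$ has the vertices $\underline g\,s_1\cdots s_i\langle\Delta\rangle$, $0\le i\le r$, where $s_1\cdots s_r$ is the left normal form of the representative with infimum $0$ of $\underline g^{-1}h\langle\Delta\rangle$. Let $x\in G$ with $\inf(x)=0$ and $\ell=\ell(x)$ be such that - $x$ is right-rigid: if $x=x_r\cdots x_1$ is the right normal form, then $r\geq 1$ and the greatest common suffix of $x_1$ and $\Delta x_r^{-1}$ is $1$; - $x$ is Morse: the map $\mathbb Z\to\mathcal X$, $t\mapsto x^t\langle\Delta\rangle$ (the axis of $x$) is a quasi-isometric embedding,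 and for all real $\Lambda\ge1$, $K\ge0$ there is a number $M_x^{(\Lambda,K)}$ such that every $(\Lambda,K)$-quasi-geodesic $\{0,\dots,n\}\to\mathcal X$ connecting two points of the axis stays within distance $M_x^{(\Lambda,K)}$ of the axis. Write $M_x=M_x^{(2,0)}$. For $h\in G$ put $\lambda(h)=-\max\{k\in\mathbb Z: x\not\preccurlyeq\underline{x^kh}\}$ and $\pi(h)=x^{\lambda(h)}\langle\Delta\rangle$. Then: 1. For every $h\in G$ the maximum defining $\lambda(h)$ exists. 2. There is $D\in\mathbb N$ such that $(\ast)$ for all $h\in G$ and $i\in\mathbb Z$, some vertex of $A(x^i,h)$ is at distance at most $D$ from $\pi(h)$ in $\mathcal X$. 3. Specifically, $(\ast)$ holds with $D=(\ell+1)M_x$, for any admissible choice of the constant $M_x$. 4. Let $D$ be any real number satisfying $(\ast)$, and let $h\in G$ and $k\in\mathbb Z$ be such that $d_{\mathcal X}(h,x^k)=\min_{i\in\mathbb Z}d_{\mathcal X}(h,x^i)$. Then $d_{\mathcal X}(\pi(h),x^k\langle\Delta\rangle)\le 2D$. -/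

import Mathlib

namespace Garside

/-- `x ≼ y`: the element `x` is a prefix of `y`. -/
def IsPrefix {G : Type*} [Group G] (P : Submonoid G) (x y : G) : Prop :=
  x⁻¹ * y ∈ P

/-- `x ≽ y`, read from right to left: the element `y` is a suffix of `x`. -/
def IsSuffix {G : Type*} [Group G] (P : Submonoid G) (y x : G) : Prop :=
  x * y⁻¹ ∈ P

/-- `m` is the greatest common prefix of `x` and `y`. -/
def IsGreatestCommonPrefix {G : Type*} [Group G] (P : Submonoid G) (x y m : G) : Prop :=
  IsPrefix P m x ∧ IsPrefix P m y ∧ ∀ c, IsPrefix P c x → IsPrefix P c y → IsPrefix P c m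

/-- `m` is the least common right multiple of `x` and `y`. -/
def IsLeastCommonRightMultiple {G : Type*} [Group G] (P : Submonoid G) (x y m : G) : Prop :=
  IsPrefix P x m ∧ IsPrefix P y m ∧ ∀ c, IsPrefix P x c → IsPrefix P y c → IsPrefix P m c

/-- `m` is the greatest common suffix of `x` and `y`. -/
def IsGreatestCommonSuffix {G : Type*} [Group G] (P : Submonoid G) (x y m : G) : Prop :=
  IsSuffix P m x ∧ IsSuffix P m y ∧ ∀ c, IsSuffix P c x → IsSuffix P c y → IsSuffix P c m

/-- `m` is the least common left multiple of `x` and `y`. -/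
def IsLeastCommonLeftMultiple {G : Type*} [Group G] (P : Submonoid G) (x y m : G) : Prop :=
  IsSuffix P x m ∧ IsSuffix P y m ∧ ∀ c, IsSuffix P x c → IsSuffix P y c → IsSuffix P m c

/-- The set of simple elements: the positive prefixes of `Δ`. -/
def simples {G : Type*} [Group G] (P : Submonoid G) (Δ : G) : Set G :=
  {s | s ∈ P ∧ IsPrefix P s Δ}

/-- `(P, Δ)` is a Garside structure on the group `G`. -/
structure IsGarsideStructure {G : Type*} [Group G] (P : Submonoid G) (Δ : G) : Prop where
  /-- The only positive element with positive inverse is `1`. -/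
  pointed : ∀ x ∈ P, x⁻¹ ∈ P → x = 1
  /-- The Garside element is positive. -/
  delta_mem : Δ ∈ P
  exists_prefix_inf : ∀ x y, ∃ m, IsGreatestCommonPrefix P x y m
  exists_prefix_sup : ∀ x y, ∃ m, IsLeastCommonRightMultiple P x y m
  exists_suffix_inf : ∀ x y, ∃ m, IsGreatestCommonSuffix P x y m
  exists_suffix_sup : ∀ x y, ∃ m, IsLeastCommonLeftMultiple P x y m
  /-- The positive prefixes of `Δ` are its positive suffixes. -/
  simples_eq : simples P Δ = {s | s ∈ P ∧ IsSuffix P s Δ}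
  /-- The simple elements generate the positive monoid. -/
  closure_monoid : Submonoid.closure (simples P Δ) = P
  /-- The simple elements generate the group. -/
  closure_group : Subgroup.closure (simples P Δ) = ⊤
  /-- For each positive `x ≠ 1`, the number of factors in a decomposition of `x` into nontrivial
  positive elements is bounded. -/
  norm_finite : ∀ x ∈ P, x ≠ 1 →
    ∃ N : ℕ, ∀ l : List G, (∀ a ∈ l, a ∈ P ∧ a ≠ 1) → l.prod = x → l.length ≤ N

/-- Proper simple elements: those different from `1` and `Δ`. -/
def IsProperSimple {G : Type*} [Group G] (P : Submonoid G) (Δ : G) (s : G) : Prop :=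
  s ∈ simples P Δ ∧ s ≠ 1 ∧ s ≠ Δ

/-- `inf g`, the largest `r` with `Δ ^ r ≼ g`. -/
noncomputable def infimum {G : Type*} [Group G] (P : Submonoid G) (Δ g : G) : ℤ :=
  sSup {r : ℤ | IsPrefix P (Δ ^ r) g}

/-- `sup g`, the smallest `s` with `g ≼ Δ ^ s`. -/
noncomputable def supremum {G : Type*} [Group G] (P : Submonoid G) (Δ g : G) : ℤ :=
  sInf {s : ℤ | IsPrefix P g (Δ ^ s)}

/-- The canonical length `ℓ g = sup g - inf g`. -/
noncomputable def canonicalLength {G : Type*} [Group G] (P : Submonoid G) (Δ g : G) : ℤ :=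
  supremum P Δ g - infimum P Δ g

/-- A pair `(s, t)` is left-weighted: `∂ s ∧ t = 1`, where `∂ s = s⁻¹ Δ`. -/
def LeftWeighted {G : Type*} [Group G] (P : Submonoid G) (Δ s t : G) : Prop :=
  IsGreatestCommonPrefix P (s⁻¹ * Δ) t 1

/-- A pair `(s, t)` is right-weighted: the greatest common suffix of `∂⁻¹ t = Δ t⁻¹` and `s`
is `1`. -/
def RightWeighted {G : Type*} [Group G] (P : Submonoid G) (Δ s t : G) : Prop :=
  IsGreatestCommonSuffix P (Δ * t⁻¹) s 1

/-- The list `[s₁, …, s_r]` is the left normal form `g = Δ ^ (inf g) s₁ ⋯ s_r`. -/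
def IsLeftNormalForm {G : Type*} [Group G] (P : Submonoid G) (Δ : G) (l : List G) (g : G) : Prop :=
  g = Δ ^ infimum P Δ g * l.prod ∧ (∀ s ∈ l, IsProperSimple P Δ s) ∧
    l.IsChain (LeftWeighted P Δ)

/-- The list `[s_r, …, s₁]` (in the order in which it is written) is the right normal form
`g = s_r ⋯ s₁ Δ ^ (inf g)`. -/
def IsRightNormalForm {G : Type*} [Group G] (P : Submonoid G) (Δ : G) (l : List G) (g : G) : Prop :=
  g = l.prod * Δ ^ infimum P Δ g ∧ (∀ s ∈ l, IsProperSimple P Δ s) ∧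
    l.IsChain (RightWeighted P Δ)

/-- `x` is right-rigid: with right normal form `x = x_r ⋯ x₁ Δ ^ p`, the greatest common suffix
of `τ ^ p (x₁) = Δ ^ (-p) x₁ Δ ^ p` and `∂⁻¹ (x_r) = Δ x_r⁻¹` is trivial. -/
def IsRightRigid {G : Type*} [Group G] (P : Submonoid G) (Δ x : G) : Prop :=
  ∃ (l : List G) (hl : l ≠ []), IsRightNormalForm P Δ l x ∧
    IsGreatestCommonSuffix P
      (Δ ^ (-infimum P Δ x) * l.getLast hl * Δ ^ infimum P Δ x) (Δ * (l.head hl)⁻¹) 1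

/-- The distinguished representative `g Δ ^ (-inf g)` of the coset `g ⟨Δ⟩`. -/
noncomputable def rep {G : Type*} [Group G] (P : Submonoid G) (Δ g : G) : G :=
  g * Δ ^ (-infimum P Δ g)

/-- The vertices of the graph `𝒳`: the left cosets `g ⟨Δ⟩`. -/
abbrev Vertex {G : Type*} [Group G] (Δ : G) : Type _ :=
  G ⧸ Subgroup.zpowers Δ

/-- The vertex `g ⟨Δ⟩` of `𝒳`. -/
def vertex {G : Type*} [Group G] (Δ g : G) : Vertex Δ :=
  QuotientGroup.mk g

/-- The graph `𝒳`: the vertices `g ⟨Δ⟩` and `h ⟨Δ⟩` are joined by an edge when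
`rep g * s ∈ h ⟨Δ⟩` for some proper simple `s`. (In a Garside group this relation is already
symmetric and irreflexive.) -/
def graphX {G : Type*} [Group G] (P : Submonoid G) (Δ : G) : SimpleGraph (Vertex Δ) :=
  SimpleGraph.fromRel fun u v =>
    ∃ g s : G, IsProperSimple P Δ s ∧ u = vertex Δ g ∧ v = vertex Δ (rep P Δ g * s)

/-- The graph metric of `𝒳`. -/
noncomputable def distX {G : Type*} [Group G] (P : Submonoid G) (Δ : G) (u v : Vertex Δ) : ℝ :=
  ((graphX P Δ).dist u v : ℝ)

/-- The set of vertices of the preferred path `A(g, h)`: if `s₁ ⋯ s_r` is the left normal form of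
the distinguished representative of the coset of `(rep g)⁻¹ h`, these are the vertices
`(rep g) s₁ ⋯ s_i ⟨Δ⟩` with `0 ≤ i ≤ r`. -/
def preferredPath {G : Type*} [Group G] (P : Submonoid G) (Δ g h : G) : Set (Vertex Δ) :=
  {v | ∃ l : List G, IsLeftNormalForm P Δ l (rep P Δ ((rep P Δ g)⁻¹ * h)) ∧
    ∃ i ≤ l.length, v = vertex Δ (rep P Δ g * (l.take i).prod)}

/-- `γ : ℤ → X` is a quasi-isometric embedding for the distance `d`. -/
def IsQuasiIsometricEmbedding {X : Type*} (d : X → X → ℝ) (γ : ℤ → X) : Prop :=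
  ∃ A B : ℝ, 1 ≤ A ∧ 0 ≤ B ∧ ∀ s t : ℤ,
    |(s : ℝ) - t| / A - B ≤ d (γ s) (γ t) ∧ d (γ s) (γ t) ≤ A * |(s : ℝ) - t| + B

/-- The restriction of `c` to `{0, …, n}` is a `(Λ, K)`-quasi-geodesic for the distance `d`. -/
def IsQuasiGeodesic {X : Type*} (d : X → X → ℝ) (Λ K : ℝ) (n : ℕ) (c : ℕ → X) : Prop :=
  ∀ s ≤ n, ∀ t ≤ n,
    |(s : ℝ) - t| / Λ - K ≤ d (c s) (c t) ∧ d (c s) (c t) ≤ Λ * |(s : ℝ) - t| + K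

/-- `M` is a Morse constant of `γ` for `(Λ, K)`: every `(Λ, K)`-quasi-geodesic connecting two
points of the image of `γ` stays in the `M`-neighbourhood of that image. -/
def IsMorseConstant {X : Type*} (d : X → X → ℝ) (γ : ℤ → X) (Λ K M : ℝ) : Prop :=
  ∀ (n : ℕ) (c : ℕ → X), IsQuasiGeodesic d Λ K n c →
    (∃ i, c 0 = γ i) → (∃ j, c n = γ j) → ∀ t ≤ n, ∃ k, d (c t) (γ k) ≤ M

/-- The map `γ : ℤ → X` is Morse for the distance `d`. -/
def IsMorseMap {X : Type*} (d : X → X → ℝ) (γ : ℤ → X) : Prop :=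
  IsQuasiIsometricEmbedding d γ ∧
    ∀ Λ K : ℝ, 1 ≤ Λ → 0 ≤ K → ∃ M : ℝ, IsMorseConstant d γ Λ K M

/-- The axis of `x` in `𝒳`, parametrised by `t ↦ x ^ t ⟨Δ⟩`. -/
def axis {G : Type*} [Group G] (Δ x : G) (t : ℤ) : Vertex Δ :=
  vertex Δ (x ^ t)

/-- `x` is Morse: its axis in `𝒳` is Morse. -/
def IsMorse {G : Type*} [Group G] (P : Submonoid G) (Δ x : G) : Prop :=
  IsMorseMap (distX P Δ) (axis Δ x)

/-- The set of integers `k` such that `x` is not a prefix of the distinguished representative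
of `x ^ k h ⟨Δ⟩`. -/
def nonPrefixSet {G : Type*} [Group G] (P : Submonoid G) (Δ x h : G) : Set ℤ :=
  {k | ¬ IsPrefix P x (rep P Δ (x ^ k * h))}

/-- The integer `λ(h) = - max {k ∈ ℤ | x ⋠ rep (x ^ k h)}`. -/
noncomputable def lam {G : Type*} [Group G] (P : Submonoid G) (Δ x h : G) : ℤ :=
  -sSup (nonPrefixSet P Δ x h)

/-- The Garside-theoretical projection to the axis of `x`: `π(h) = x ^ λ(h) ⟨Δ⟩`. -/
noncomputable def proj {G : Type*} [Group G] (P : Submonoid G) (Δ x h : G) : Vertex Δ :=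
  axis Δ x (lam P Δ x h)

/-- Every preferred path `A(x ^ i, h)` passes at distance at most `D` from `π(h)`. -/
def PassesNearProj {G : Type*} [Group G] (P : Submonoid G) (Δ x : G) (D : ℝ) : Prop :=
  ∀ (h : G) (i : ℤ), ∃ v ∈ preferredPath P Δ (x ^ i) h, distX P Δ v (proj P Δ x h) ≤ D

end Garside

/-!
The argument is elementary lattice theory in the prefix order. The canonical length gives the
metric: `d(g, h) = ℓ(g⁻¹ h)` (`distX_vertex`), the preferred path from `g` to `h` runs through the
truncations `z ∧ Δ ^ n` of the representative `z` of `g⁻¹ h ⟨Δ⟩` with infimum `0`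
(`vertex_mul_mem_preferredPath`), and it is a geodesic
(`distX_add_distX_le_of_mem_preferredPath`).

Put `f(k) = inf(x ^ k h)`, a nondecreasing function of `k`. Then `x` is a prefix of
`rep (x ^ k h)` exactly when `f(k) = f(k - 1)`. Right-rigidity means that `x ^ n` ends with the
same simple factor as `x`, so `f(k) = f(k - 1)` implies `f(k + 1) = f(k)` (`infimum_mul_mul`).
Since `f` is bounded above and unbounded below, it increases strictly up to `m = -λ(h)` and is
constant from there on, which is the existence of the maximum (`isGreatest_nonPrefixSet`).

Let `z = rep (x ^ m h)`; the projection of `z` is the vertex `1`. Seen from `x ^ (-k)` with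
`k ≥ 0`, the path to `z` passes through `w = x ^ k z ∧ Δ ^ (k ℓ)`, translated back by `x ^ (-k)`;
here `x ^ k ≼ w` have the same supremum, and going from `1` up to `w` and down to `x ^ k` is a
`(2, 0)`-quasi-geodesic, so that `w` is close to the axis and then to `x ^ k`
(`distX_trunc_pow_mul_le`). Seen from `x ^ k`, the path passes through `b = x ^ k ∧ z`; going from
`1` to `b` to `x ^ k` is a `(2, 0)`-quasi-geodesic, so `b` is within `M` of some `x ^ j`, and
`inf(x ^ (-j) b) ≤ f(m - j) - f(m) ≤ -j` bounds `j` by `M` if `j ≥ 0` (`distX_one_le_of_isPrefix`).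
That leaves `b` within `(ℓ + 1) M` of `1`. The comparison with closest points uses only that
preferred paths are geodesics (`distX_proj_le`).

Statements on right normal forms come from those on left normal forms in the opposite group.
-/

namespace Garside

variable {G : Type*} [Group G] {P : Submonoid G} {Δ : G}

/-! ### The prefix order and conjugation by the Garside element -/

theorem IsPrefix.refl (g : G) : IsPrefix P g g := by
  simp [IsPrefix]

theorem IsPrefix.trans {a b c : G} (h₁ : IsPrefix P a b) (h₂ : IsPrefix P b c) :
    IsPrefix P a c := by
  simpa [IsPrefix, mul_assoc] using P.mul_mem h₁ h₂

theorem isPrefix_mul_left_iff (a : G) {b c : G} :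
    IsPrefix P (a * b) (a * c) ↔ IsPrefix P b c := by
  simp [IsPrefix, mul_assoc]

theorem isPrefix_mul_iff {a b c : G} : IsPrefix P (a * b) c ↔ IsPrefix P b (a⁻¹ * c) := by
  simp [IsPrefix, mul_assoc]

theorem isPrefix_one_iff {a : G} : IsPrefix P 1 a ↔ a ∈ P := by
  simp [IsPrefix]

theorem isPrefix_mul_self {a b : G} (hb : b ∈ P) : IsPrefix P a (a * b) := by
  simpa [IsPrefix] using hb

theorem IsPrefix.mem {a b : G} (h : IsPrefix P a b) (ha : a ∈ P) : b ∈ P :=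
  isPrefix_one_iff.1 ((isPrefix_one_iff.2 ha).trans h)

namespace IsGarsideStructure

theorem isPrefix_antisymm (hG : IsGarsideStructure P Δ) {a b : G} (h₁ : IsPrefix P a b)
    (h₂ : IsPrefix P b a) : a = b := by
  have h := hG.pointed _ h₁ (by simpa [IsPrefix] using h₂)
  rwa [inv_mul_eq_one] at h

/-- Conjugation by `Δ` preserves the positive monoid: the complement of a simple element, on
either side, is again a prefix and a suffix of `Δ`. -/
theorem conj_mem (hG : IsGarsideStructure P Δ) {a : G} (ha : a ∈ P) :
    Δ * a * Δ⁻¹ ∈ P ∧ Δ⁻¹ * a * Δ ∈ P := by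
  rw [← hG.closure_monoid] at ha
  induction ha using Submonoid.closure_induction with
  | mem s hs =>
    constructor
    · have h : s ∈ {s | s ∈ P ∧ IsSuffix P s Δ} := hG.simples_eq ▸ hs
      have hv : Δ * s⁻¹ ∈ simples P Δ := by
        refine ⟨h.2, ?_⟩
        simpa [IsPrefix] using h.1
      rw [hG.simples_eq] at hv
      simpa [IsSuffix, mul_assoc] using hv.2
    · have hv : s⁻¹ * Δ ∈ {s | s ∈ P ∧ IsSuffix P s Δ} := by
        refine ⟨hs.2, ?_⟩
        simpa [IsSuffix] using hs.1
      rw [← hG.simples_eq] at hv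
      simpa [IsPrefix, mul_assoc] using hv.2
  | one => simp [P.one_mem]
  | mul a b _ _ iha ihb =>
    have h₁ := P.mul_mem iha.1 ihb.1
    have h₂ := P.mul_mem iha.2 ihb.2
    simp only [mul_assoc, inv_mul_cancel_left, mul_inv_cancel_left] at h₁ h₂ ⊢
    exact ⟨h₁, h₂⟩

theorem zpow_conj_mem (hG : IsGarsideStructure P Δ) {a : G} (ha : a ∈ P) (n : ℤ) :
    Δ ^ n * a * Δ ^ (-n) ∈ P := by
  induction n using Int.induction_on with
  | zero => simpa using ha
  | succ n ih => convert (hG.conj_mem ih).1 using 1; group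
  | pred n ih => convert (hG.conj_mem ih).2 using 1; group

theorem zpow_mul_mem_iff (hG : IsGarsideStructure P Δ) {g : G} (n : ℤ) :
    Δ ^ n * g ∈ P ↔ g * Δ ^ n ∈ P := by
  constructor <;> intro h
  · convert hG.zpow_conj_mem h (-n) using 1; group
  · convert hG.zpow_conj_mem h n using 1; group

theorem isPrefix_mul_zpow_iff (hG : IsGarsideStructure P Δ) {a b : G} (n : ℤ) :
    IsPrefix P (a * Δ ^ n) (b * Δ ^ n) ↔ IsPrefix P a b := by
  unfold IsPrefix
  rw [show (a * Δ ^ n)⁻¹ * (b * Δ ^ n) = Δ ^ (-n) * (a⁻¹ * b * Δ ^ n) by group,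
    hG.zpow_mul_mem_iff, mul_assoc, ← zpow_add]
  simp

theorem isPrefix_mul_zpow_iff' (hG : IsGarsideStructure P Δ) {a b : G} (n : ℤ) :
    IsPrefix P (a * Δ ^ n) b ↔ IsPrefix P a (b * Δ ^ (-n)) := by
  rw [← hG.isPrefix_mul_zpow_iff (-n)]
  simp

theorem zpow_mem (hG : IsGarsideStructure P Δ) {n : ℤ} (hn : 0 ≤ n) : Δ ^ n ∈ P := by
  lift n to ℕ using hn
  simpa using P.pow_mem hG.delta_mem n

theorem nonneg_of_zpow_mem (hG : IsGarsideStructure P Δ) (hΔ : Δ ≠ 1) {n : ℤ}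
    (h : Δ ^ n ∈ P) : 0 ≤ n := by
  by_contra! hn
  refine hΔ (hG.pointed _ hG.delta_mem ?_)
  convert P.mul_mem h (hG.zpow_mem (n := -n - 1) (by lia)) using 1
  rw [← zpow_add, ← zpow_neg_one]
  congr 1
  lia

/-! ### Infimum, supremum and canonical length -/

theorem exists_isPrefix_zpow (hG : IsGarsideStructure P Δ) (g : G) :
    (∃ r : ℤ, IsPrefix P (Δ ^ r) g) ∧ ∃ s : ℤ, IsPrefix P g (Δ ^ s) := by
  have hg : g ∈ Subgroup.closure (simples P Δ) := hG.closure_group ▸ Subgroup.mem_top g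
  induction hg using Subgroup.closure_induction with
  | mem s hs => exact ⟨⟨0, by simpa [IsPrefix] using hs.1⟩, ⟨1, by simpa using hs.2⟩⟩
  | one => exact ⟨⟨0, by simp [IsPrefix, P.one_mem]⟩, ⟨0, by simp [IsPrefix, P.one_mem]⟩⟩
  | mul a b _ _ iha ihb =>
    obtain ⟨⟨r, hr⟩, s, hs⟩ := iha
    obtain ⟨⟨r', hr'⟩, s', hs'⟩ := ihb
    refine ⟨⟨r + r', ?_⟩, s + s', ?_⟩
    · rw [zpow_add]
      refine IsPrefix.trans ((hG.isPrefix_mul_zpow_iff r').2 hr) ((isPrefix_mul_left_iff a).2 hr')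
    · rw [zpow_add]
      refine IsPrefix.trans ((isPrefix_mul_left_iff a).2 hs') ((hG.isPrefix_mul_zpow_iff s').2 hs)
  | inv a _ ih =>
    obtain ⟨⟨r, hr⟩, s, hs⟩ := ih
    refine ⟨⟨-s, ?_⟩, -r, ?_⟩
    · have := (hG.zpow_mul_mem_iff s).2 hs
      simpa [IsPrefix] using this
    · have := (hG.zpow_mul_mem_iff (-r)).1 (by simpa [IsPrefix] using hr)
      simpa [IsPrefix] using this

theorem isPrefix_zpow_zpow_iff (hG : IsGarsideStructure P Δ) (hΔ : Δ ≠ 1) {r s : ℤ} :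
    IsPrefix P (Δ ^ r) (Δ ^ s) ↔ r ≤ s := by
  unfold IsPrefix
  rw [← zpow_neg, ← zpow_add]
  refine ⟨fun h => ?_, fun h => hG.zpow_mem (by lia)⟩
  have := hG.nonneg_of_zpow_mem hΔ h
  lia

theorem le_infimum_iff (hG : IsGarsideStructure P Δ) (hΔ : Δ ≠ 1) {r : ℤ} {g : G} :
    r ≤ infimum P Δ g ↔ IsPrefix P (Δ ^ r) g := by
  have hne := (hG.exists_isPrefix_zpow g).1
  obtain ⟨s, hs⟩ := (hG.exists_isPrefix_zpow g).2
  have hb : BddAbove {r : ℤ | IsPrefix P (Δ ^ r) g} :=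
    ⟨s, fun r hr => (hG.isPrefix_zpow_zpow_iff hΔ).1 (IsPrefix.trans hr hs)⟩
  refine ⟨fun h => ?_, fun h => le_csSup hb h⟩
  exact ((hG.isPrefix_zpow_zpow_iff hΔ).2 h).trans (Int.csSup_mem hne hb)

theorem supremum_le_iff (hG : IsGarsideStructure P Δ) (hΔ : Δ ≠ 1) {s : ℤ} {g : G} :
    supremum P Δ g ≤ s ↔ IsPrefix P g (Δ ^ s) := by
  have hne := (hG.exists_isPrefix_zpow g).2
  obtain ⟨r, hr⟩ := (hG.exists_isPrefix_zpow g).1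
  have hb : BddBelow {s : ℤ | IsPrefix P g (Δ ^ s)} :=
    ⟨r, fun s hs => (hG.isPrefix_zpow_zpow_iff hΔ).1 (hr.trans hs)⟩
  refine ⟨fun h => ?_, fun h => csInf_le hb h⟩
  exact IsPrefix.trans (Int.csInf_mem hne hb) ((hG.isPrefix_zpow_zpow_iff hΔ).2 h)

theorem zpow_infimum_isPrefix (hG : IsGarsideStructure P Δ) (hΔ : Δ ≠ 1) (g : G) :
    IsPrefix P (Δ ^ infimum P Δ g) g :=
  (hG.le_infimum_iff hΔ).1 le_rfl

theorem isPrefix_zpow_supremum (hG : IsGarsideStructure P Δ) (hΔ : Δ ≠ 1) (g : G) :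
    IsPrefix P g (Δ ^ supremum P Δ g) :=
  (hG.supremum_le_iff hΔ).1 le_rfl

theorem infimum_nonneg_iff (hG : IsGarsideStructure P Δ) (hΔ : Δ ≠ 1) {g : G} :
    0 ≤ infimum P Δ g ↔ g ∈ P := by
  rw [hG.le_infimum_iff hΔ, zpow_zero, isPrefix_one_iff]

theorem infimum_le_supremum (hG : IsGarsideStructure P Δ) (hΔ : Δ ≠ 1) (g : G) :
    infimum P Δ g ≤ supremum P Δ g :=
  (hG.isPrefix_zpow_zpow_iff hΔ).1
    ((hG.zpow_infimum_isPrefix hΔ g).trans (hG.isPrefix_zpow_supremum hΔ g))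

theorem infimum_mono (hG : IsGarsideStructure P Δ) (hΔ : Δ ≠ 1) {a b : G}
    (h : IsPrefix P a b) : infimum P Δ a ≤ infimum P Δ b :=
  (hG.le_infimum_iff hΔ).2 ((hG.zpow_infimum_isPrefix hΔ a).trans h)

theorem supremum_mono (hG : IsGarsideStructure P Δ) (hΔ : Δ ≠ 1) {a b : G}
    (h : IsPrefix P a b) : supremum P Δ a ≤ supremum P Δ b :=
  (hG.supremum_le_iff hΔ).2 (h.trans (hG.isPrefix_zpow_supremum hΔ b))

theorem infimum_mul_le (hG : IsGarsideStructure P Δ) (hΔ : Δ ≠ 1) (a b : G) :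
    infimum P Δ a + infimum P Δ b ≤ infimum P Δ (a * b) := by
  rw [hG.le_infimum_iff hΔ, zpow_add]
  exact ((hG.isPrefix_mul_zpow_iff _).2 (hG.zpow_infimum_isPrefix hΔ a)).trans
    ((isPrefix_mul_left_iff a).2 (hG.zpow_infimum_isPrefix hΔ b))

theorem infimum_inv (hG : IsGarsideStructure P Δ) (hΔ : Δ ≠ 1) (g : G) :
    infimum P Δ g⁻¹ = -supremum P Δ g := by
  refine eq_of_forall_le_iff fun r => ?_
  rw [hG.le_infimum_iff hΔ, le_neg, hG.supremum_le_iff hΔ]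
  unfold IsPrefix
  rw [← zpow_neg, hG.zpow_mul_mem_iff]

theorem supremum_inv (hG : IsGarsideStructure P Δ) (hΔ : Δ ≠ 1) (g : G) :
    supremum P Δ g⁻¹ = -infimum P Δ g := by
  have := hG.infimum_inv hΔ g⁻¹
  rw [inv_inv] at this
  lia

theorem supremum_mul_le (hG : IsGarsideStructure P Δ) (hΔ : Δ ≠ 1) (a b : G) :
    supremum P Δ (a * b) ≤ supremum P Δ a + supremum P Δ b := by
  have := hG.infimum_mul_le hΔ b⁻¹ a⁻¹
  rw [← mul_inv_rev, hG.infimum_inv hΔ, hG.infimum_inv hΔ, hG.infimum_inv hΔ] at this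
  lia

theorem infimum_mul_le_supremum (hG : IsGarsideStructure P Δ) (hΔ : Δ ≠ 1) (a b : G) :
    infimum P Δ (a * b) ≤ infimum P Δ a + supremum P Δ b := by
  have := hG.infimum_mul_le hΔ (a * b) b⁻¹
  rw [hG.infimum_inv hΔ, mul_inv_cancel_right] at this
  lia

theorem infimum_zpow (hG : IsGarsideStructure P Δ) (hΔ : Δ ≠ 1) (n : ℤ) :
    infimum P Δ (Δ ^ n) = n :=
  eq_of_forall_le_iff fun r => by
    rw [hG.le_infimum_iff hΔ, hG.isPrefix_zpow_zpow_iff hΔ]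

theorem supremum_zpow (hG : IsGarsideStructure P Δ) (hΔ : Δ ≠ 1) (n : ℤ) :
    supremum P Δ (Δ ^ n) = n :=
  eq_of_forall_ge_iff fun r => by
    rw [hG.supremum_le_iff hΔ, hG.isPrefix_zpow_zpow_iff hΔ]

theorem infimum_mul_zpow (hG : IsGarsideStructure P Δ) (hΔ : Δ ≠ 1) (g : G) (n : ℤ) :
    infimum P Δ (g * Δ ^ n) = infimum P Δ g + n := by
  have h₁ := hG.infimum_mul_le hΔ g (Δ ^ n)
  have h₂ := hG.infimum_mul_le_supremum hΔ g (Δ ^ n)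
  rw [hG.infimum_zpow hΔ] at h₁
  rw [hG.supremum_zpow hΔ] at h₂
  lia

theorem supremum_mul_zpow (hG : IsGarsideStructure P Δ) (hΔ : Δ ≠ 1) (g : G) (n : ℤ) :
    supremum P Δ (g * Δ ^ n) = supremum P Δ g + n := by
  have h₁ := hG.supremum_mul_le hΔ g (Δ ^ n)
  have h₂ := hG.supremum_mul_le hΔ (g * Δ ^ n) (Δ ^ (-n))
  rw [hG.supremum_zpow hΔ] at h₁ h₂
  rw [mul_assoc, ← zpow_add, add_neg_cancel, zpow_zero, mul_one] at h₂
  lia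

theorem canonicalLength_inv (hG : IsGarsideStructure P Δ) (hΔ : Δ ≠ 1) (g : G) :
    canonicalLength P Δ g⁻¹ = canonicalLength P Δ g := by
  unfold canonicalLength
  rw [hG.infimum_inv hΔ, hG.supremum_inv hΔ]
  lia

theorem canonicalLength_mul_le (hG : IsGarsideStructure P Δ) (hΔ : Δ ≠ 1) (a b : G) :
    canonicalLength P Δ (a * b) ≤ canonicalLength P Δ a + canonicalLength P Δ b := by
  have h₁ := hG.infimum_mul_le hΔ a b
  have h₂ := hG.supremum_mul_le hΔ a b
  unfold canonicalLength
  lia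

theorem canonicalLength_mul_zpow (hG : IsGarsideStructure P Δ) (hΔ : Δ ≠ 1) (g : G) (n : ℤ) :
    canonicalLength P Δ (g * Δ ^ n) = canonicalLength P Δ g := by
  unfold canonicalLength
  rw [hG.infimum_mul_zpow hΔ, hG.supremum_mul_zpow hΔ]
  lia

theorem canonicalLength_zpow_mul (hG : IsGarsideStructure P Δ) (hΔ : Δ ≠ 1) (g : G) (n : ℤ) :
    canonicalLength P Δ (Δ ^ n * g) = canonicalLength P Δ g := by
  rw [← hG.canonicalLength_inv hΔ, mul_inv_rev, ← zpow_neg, hG.canonicalLength_mul_zpow hΔ,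
    hG.canonicalLength_inv hΔ]

theorem canonicalLength_nonneg (hG : IsGarsideStructure P Δ) (hΔ : Δ ≠ 1) (g : G) :
    0 ≤ canonicalLength P Δ g :=
  sub_nonneg.2 (hG.infimum_le_supremum hΔ g)

theorem canonicalLength_one (hG : IsGarsideStructure P Δ) (hΔ : Δ ≠ 1) :
    canonicalLength P Δ 1 = 0 := by
  have h₁ := hG.infimum_zpow hΔ 0
  have h₂ := hG.supremum_zpow hΔ 0
  rw [zpow_zero] at h₁ h₂
  rw [canonicalLength, h₁, h₂, sub_zero]

end IsGarsideStructure

/-! ### Truncations and left normal forms -/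

/-- The truncation `z ∧ Δ ^ n`, the greatest common prefix of `z` and `Δ ^ n`. For `z` positive
with infimum `0` and `0 ≤ n` it is the product of the first `n` factors of the left normal form
of `z`. (It is an arbitrary element if there is no greatest common prefix.) -/
noncomputable def trunc (P : Submonoid G) (Δ z : G) (n : ℤ) : G :=
  Classical.epsilon (IsGreatestCommonPrefix P z (Δ ^ n))

/-- The list of the first `n` factors of the left normal form of a positive element `z` with
infimum `0`. -/
noncomputable def normalFormList (P : Submonoid G) (Δ z : G) (n : ℕ) : List G :=
  (List.range n).map fun j : ℕ => (trunc P Δ z j)⁻¹ * trunc P Δ z (j + 1)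

namespace IsGarsideStructure

theorem isGreatestCommonPrefix_unique (hG : IsGarsideStructure P Δ) {a b m m' : G}
    (h : IsGreatestCommonPrefix P a b m) (h' : IsGreatestCommonPrefix P a b m') : m = m' :=
  hG.isPrefix_antisymm (h'.2.2 _ h.1 h.2.1) (h.2.2 _ h'.1 h'.2.1)

theorem trunc_spec (hG : IsGarsideStructure P Δ) (z : G) (n : ℤ) :
    IsGreatestCommonPrefix P z (Δ ^ n) (trunc P Δ z n) :=
  Classical.epsilon_spec (hG.exists_prefix_inf z (Δ ^ n))

theorem trunc_mono (hG : IsGarsideStructure P Δ) (hΔ : Δ ≠ 1) (z : G) {s t : ℤ} (h : s ≤ t) :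
    IsPrefix P (trunc P Δ z s) (trunc P Δ z t) :=
  (hG.trunc_spec z t).2.2 _ (hG.trunc_spec z s).1
    ((hG.trunc_spec z s).2.1.trans ((hG.isPrefix_zpow_zpow_iff hΔ).2 h))

theorem trunc_mem (hG : IsGarsideStructure P Δ) {z : G} (hz : z ∈ P) {s : ℤ} (hs : 0 ≤ s) :
    trunc P Δ z s ∈ P :=
  isPrefix_one_iff.1
    ((hG.trunc_spec z s).2.2 _ (isPrefix_one_iff.2 hz) (isPrefix_one_iff.2 (hG.zpow_mem hs)))

theorem trunc_zero (hG : IsGarsideStructure P Δ) {z : G} (hz : z ∈ P) : trunc P Δ z 0 = 1 :=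
  hG.isGreatestCommonPrefix_unique (hG.trunc_spec z 0)
    ⟨isPrefix_one_iff.2 hz, by simpa using IsPrefix.refl 1, fun c _ h => by simpa using h⟩

theorem trunc_of_supremum_le (hG : IsGarsideStructure P Δ) (hΔ : Δ ≠ 1) {z : G} {n : ℤ}
    (h : supremum P Δ z ≤ n) : trunc P Δ z n = z :=
  hG.isGreatestCommonPrefix_unique (hG.trunc_spec z n)
    ⟨IsPrefix.refl z, (hG.supremum_le_iff hΔ).1 h, fun _ h _ => h⟩

theorem supremum_trunc_le (hG : IsGarsideStructure P Δ) (hΔ : Δ ≠ 1) (z : G) (n : ℤ) :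
    supremum P Δ (trunc P Δ z n) ≤ n :=
  (hG.supremum_le_iff hΔ).2 (hG.trunc_spec z n).2.1

theorem trunc_isPrefix_mul_zpow (hG : IsGarsideStructure P Δ) (z : G) {s t : ℤ} (h : s ≤ t) :
    IsPrefix P (trunc P Δ z t) (trunc P Δ z s * Δ ^ (t - s)) := by
  have hc : IsPrefix P (trunc P Δ z t * Δ ^ (-(t - s))) (trunc P Δ z t) := by
    rw [hG.isPrefix_mul_zpow_iff']
    simpa using isPrefix_mul_self (hG.zpow_mem (sub_nonneg.2 h))
  rw [← hG.isPrefix_mul_zpow_iff (-(t - s)), mul_assoc (trunc P Δ z s), ← zpow_add,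
    add_neg_cancel, zpow_zero, mul_one]
  refine (hG.trunc_spec z s).2.2 _ (hc.trans (hG.trunc_spec z t).1) ?_
  rw [hG.isPrefix_mul_zpow_iff', ← zpow_add]
  convert (hG.trunc_spec z t).2.1 using 2
  lia

theorem supremum_inv_trunc_mul_trunc_le (hG : IsGarsideStructure P Δ) (hΔ : Δ ≠ 1) (z : G)
    {s t : ℤ} (h : s ≤ t) :
    supremum P Δ ((trunc P Δ z s)⁻¹ * trunc P Δ z t) ≤ t - s := by
  rw [hG.supremum_le_iff hΔ, ← isPrefix_mul_left_iff (trunc P Δ z s), mul_inv_cancel_left]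
  exact hG.trunc_isPrefix_mul_zpow z h

/-- Truncations of `z` are spaced as far apart as the number of simple factors between them:
otherwise `z` would have a smaller supremum. -/
theorem supremum_inv_trunc_mul_trunc (hG : IsGarsideStructure P Δ) (hΔ : Δ ≠ 1) {z : G}
    {s t : ℤ} (hst : s ≤ t) (ht : t ≤ supremum P Δ z) :
    supremum P Δ ((trunc P Δ z s)⁻¹ * trunc P Δ z t) = t - s := by
  refine le_antisymm (hG.supremum_inv_trunc_mul_trunc_le hΔ z hst) ?_
  have h₁ := hG.supremum_inv_trunc_mul_trunc_le hΔ z ht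
  rw [hG.trunc_of_supremum_le hΔ le_rfl] at h₁
  have h₂ := hG.supremum_trunc_le hΔ z s
  have h₃ := hG.supremum_mul_le hΔ (trunc P Δ z t) ((trunc P Δ z t)⁻¹ * z)
  have h₄ := hG.supremum_mul_le hΔ (trunc P Δ z s) ((trunc P Δ z s)⁻¹ * trunc P Δ z t)
  rw [mul_inv_cancel_left] at h₃ h₄
  lia

theorem infimum_inv_trunc_mul_trunc (hG : IsGarsideStructure P Δ) (hΔ : Δ ≠ 1) {z : G}
    (hz : infimum P Δ z = 0) {s t : ℤ} (hs : 0 ≤ s) (hst : s ≤ t) :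
    infimum P Δ ((trunc P Δ z s)⁻¹ * trunc P Δ z t) = 0 := by
  have hzP : z ∈ P := (hG.infimum_nonneg_iff hΔ).1 hz.ge
  refine le_antisymm ?_ ((hG.infimum_nonneg_iff hΔ).2 (hG.trunc_mono hΔ z hst))
  have h₁ := hG.infimum_mul_le hΔ (trunc P Δ z s) ((trunc P Δ z s)⁻¹ * trunc P Δ z t)
  rw [mul_inv_cancel_left] at h₁
  have h₂ := (hG.infimum_nonneg_iff hΔ).2 (hG.trunc_mem hzP hs)
  have h₃ := hG.infimum_mono hΔ (hG.trunc_spec z t).1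
  lia

theorem isProperSimple_iff (hG : IsGarsideStructure P Δ) (hΔ : Δ ≠ 1) {s : G} :
    IsProperSimple P Δ s ↔ infimum P Δ s = 0 ∧ supremum P Δ s = 1 := by
  have h0 := hG.infimum_nonneg_iff hΔ (g := s)
  have h1 := hG.supremum_le_iff hΔ (g := s) (s := 1)
  rw [zpow_one] at h1
  constructor
  · rintro ⟨⟨hs, hs'⟩, hne, hne'⟩
    have h2 : ¬ 1 ≤ infimum P Δ s := fun h => by
      rw [hG.le_infimum_iff hΔ, zpow_one] at h
      exact hne' (hG.isPrefix_antisymm hs' h)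
    have h3 : ¬ supremum P Δ s ≤ 0 := fun h => by
      rw [hG.supremum_le_iff hΔ, zpow_zero] at h
      exact hne (hG.isPrefix_antisymm h (isPrefix_one_iff.2 hs))
    have := h0.2 hs
    have := h1.2 hs'
    lia
  · rintro ⟨hi, hs⟩
    refine ⟨⟨h0.1 hi.ge, h1.1 hs.le⟩, ?_, ?_⟩
    · rintro rfl
      have := hG.supremum_zpow hΔ 0
      rw [zpow_zero] at this
      lia
    · rintro rfl
      have := hG.infimum_zpow hΔ 1
      rw [zpow_one] at this
      lia

theorem normalFormList_prod (hG : IsGarsideStructure P Δ) {z : G} (hz : z ∈ P) (n : ℕ) :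
    (normalFormList P Δ z n).prod = trunc P Δ z n := by
  induction n with
  | zero => simp [normalFormList, hG.trunc_zero hz]
  | succ n ih =>
    unfold normalFormList at ih ⊢
    rw [List.range_succ, List.map_append, List.prod_append, ih]
    simp

theorem take_normalFormList (z : G) {i n : ℕ} (h : i ≤ n) :
    (normalFormList P Δ z n).take i = normalFormList P Δ z i := by
  simp [normalFormList, ← List.map_take, List.take_range, h]

theorem isLeftNormalForm_normalFormList (hG : IsGarsideStructure P Δ) (hΔ : Δ ≠ 1) {z : G}
    (hz : infimum P Δ z = 0) {n : ℕ} (hn : supremum P Δ z = n) :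
    IsLeftNormalForm P Δ (normalFormList P Δ z n) z := by
  have hzP : z ∈ P := (hG.infimum_nonneg_iff hΔ).1 hz.ge
  refine ⟨?_, ?_, ?_⟩
  · rw [hz, zpow_zero, one_mul, hG.normalFormList_prod hzP, hG.trunc_of_supremum_le hΔ hn.le]
  · intro s hs
    obtain ⟨j, hj, rfl⟩ := List.mem_map.1 hs
    rw [List.mem_range] at hj
    rw [hG.isProperSimple_iff hΔ]
    refine ⟨hG.infimum_inv_trunc_mul_trunc hΔ hz (by lia) (by lia), ?_⟩
    rw [hG.supremum_inv_trunc_mul_trunc hΔ (by lia) (by lia)]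
    lia
  · unfold normalFormList
    rw [List.isChain_map, List.isChain_range]
    intro j _
    refine ⟨?_, isPrefix_one_iff.2 (hG.trunc_mono hΔ z (by lia)), fun c hc hc' => ?_⟩
    · have := hG.trunc_isPrefix_mul_zpow z (s := j) (t := j + 1) (by lia)
      rw [isPrefix_one_iff]
      simpa [IsPrefix, mul_assoc] using this
    · push_cast at hc hc'
      rw [← isPrefix_mul_left_iff (trunc P Δ z (j + 1)), mul_one]
      refine (hG.trunc_spec z _).2.2 _ ?_ ?_
      · rw [isPrefix_mul_iff]
        refine hc'.trans ?_
        rw [isPrefix_mul_left_iff]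
        exact (hG.trunc_spec z _).1
      · rw [isPrefix_mul_iff]
        refine hc.trans ?_
        rw [mul_inv_rev, inv_inv, mul_assoc, isPrefix_mul_left_iff, zpow_add, zpow_one]
        have := (hG.isPrefix_mul_zpow_iff 1).2 (hG.trunc_spec z j).2.1
        rwa [zpow_one] at this

theorem prod_mem {l : List G} (hl : ∀ s ∈ l, IsProperSimple P Δ s) : l.prod ∈ P :=
  P.list_prod_mem fun s hs => (hl s hs).1.1

theorem supremum_prod_le (hG : IsGarsideStructure P Δ) (hΔ : Δ ≠ 1) {l : List G}
    (hl : ∀ s ∈ l, IsProperSimple P Δ s) : supremum P Δ l.prod ≤ l.length := by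
  induction l with
  | nil =>
    have := hG.supremum_zpow hΔ 0
    rw [zpow_zero] at this
    simp [this]
  | cons s l ih =>
    rw [List.forall_mem_cons] at hl
    have h₁ := ih hl.2
    have h₂ := hG.supremum_mul_le hΔ s l.prod
    have h₃ := ((hG.isProperSimple_iff hΔ).1 hl.1).2
    rw [List.prod_cons, List.length_cons]
    push_cast
    lia

theorem canonicalLength_prod_le (hG : IsGarsideStructure P Δ) (hΔ : Δ ≠ 1) {l : List G}
    (hl : ∀ s ∈ l, IsProperSimple P Δ s) : canonicalLength P Δ l.prod ≤ l.length := by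
  have h₁ := hG.supremum_prod_le hΔ hl
  have h₂ := (hG.infimum_nonneg_iff hΔ).2 (prod_mem hl)
  unfold canonicalLength
  lia

/-- In a left-weighted product of simple elements, the first factor is the greatest common prefix
with `Δ`. -/
theorem isPrefix_head_of_isChain (hG : IsGarsideStructure P Δ) {s : G} {l : List G}
    (hl : ∀ t ∈ s :: l, IsProperSimple P Δ t) (hc : (s :: l).IsChain (LeftWeighted P Δ))
    {c : G} (h₁ : IsPrefix P c (s :: l).prod) (h₂ : IsPrefix P c Δ) : IsPrefix P c s := by
  induction l generalizing s c with
  | nil => simpa using h₁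
  | cons t l ih =>
    rw [List.isChain_cons_cons] at hc
    rw [List.forall_mem_cons] at hl
    rw [List.prod_cons] at h₁
    obtain ⟨m, hcm, hsm, hm⟩ := hG.exists_prefix_sup c s
    have hm₁ := hm _ h₁ (isPrefix_mul_self (prod_mem hl.2))
    have hm₂ := hm _ h₂ hl.1.1.2
    rw [← mul_inv_cancel_left s m, isPrefix_mul_left_iff] at hm₁
    rw [← mul_inv_cancel_left s m, isPrefix_mul_iff] at hm₂
    have hs : IsPrefix P (s⁻¹ * Δ) Δ := by
      simpa [IsPrefix] using (hG.conj_mem hl.1.1.1).2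
    have := hc.1.2.2 _ hm₂ (ih hl.2 hc.2 hm₁ (hm₂.trans hs))
    rw [← isPrefix_mul_left_iff s, mul_inv_cancel_left, mul_one] at this
    exact hcm.trans this

theorem length_le_supremum_prod (hG : IsGarsideStructure P Δ) (hΔ : Δ ≠ 1) {l : List G}
    (hl : ∀ s ∈ l, IsProperSimple P Δ s) (hc : l.IsChain (LeftWeighted P Δ)) :
    (l.length : ℤ) ≤ supremum P Δ l.prod := by
  induction l with
  | nil =>
    have := hG.supremum_zpow hΔ 0
    rw [zpow_zero] at this
    simp [this]
  | cons s l ih =>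
    set n := supremum P Δ (s :: l).prod with hn
    have hl' := List.forall_mem_cons.1 hl
    have hn1 : 1 ≤ n := by
      rw [← ((hG.isProperSimple_iff hΔ).1 hl'.1).2, hn, List.prod_cons]
      exact hG.supremum_mono hΔ (isPrefix_mul_self (prod_mem hl'.2))
    suffices h : supremum P Δ l.prod ≤ n - 1 by
      have := ih hl'.2 hc.tail
      rw [List.length_cons]
      push_cast
      lia
    -- `(s :: l).prod * Δ ^ (1 - n)` is a common prefix of the product and `Δ`, hence of `s`
    have key := hG.isPrefix_head_of_isChain hl hc (c := (s :: l).prod * Δ ^ (1 - n)) (by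
        rw [hG.isPrefix_mul_zpow_iff']
        exact isPrefix_mul_self (hG.zpow_mem (by lia))) (by
        rw [hG.isPrefix_mul_zpow_iff', ← zpow_one_add, ← hG.supremum_le_iff hΔ]
        lia)
    rw [List.prod_cons, hG.isPrefix_mul_zpow_iff', isPrefix_mul_left_iff,
      ← hG.supremum_le_iff hΔ] at key
    lia

end IsGarsideStructure

/-! ### Right normal forms, by passing to the opposite group -/

section Opposite

open MulOpposite

namespace IsGarsideStructure

theorem op (hG : IsGarsideStructure P Δ) : IsGarsideStructure P.op (MulOpposite.op Δ) where
  pointed x hx hx' := unop_injective (hG.pointed _ hx hx')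
  delta_mem := hG.delta_mem
  exists_prefix_inf x y :=
    let ⟨m, h⟩ := hG.exists_suffix_inf x.unop y.unop
    ⟨.op m, h.1, h.2.1, fun c => h.2.2 c.unop⟩
  exists_prefix_sup x y :=
    let ⟨m, h⟩ := hG.exists_suffix_sup x.unop y.unop
    ⟨.op m, h.1, h.2.1, fun c => h.2.2 c.unop⟩
  exists_suffix_inf x y :=
    let ⟨m, h⟩ := hG.exists_prefix_inf x.unop y.unop
    ⟨.op m, h.1, h.2.1, fun c => h.2.2 c.unop⟩
  exists_suffix_sup x y :=
    let ⟨m, h⟩ := hG.exists_prefix_sup x.unop y.unop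
    ⟨.op m, h.1, h.2.1, fun c => h.2.2 c.unop⟩
  simples_eq := Set.ext fun s => (Set.ext_iff.1 hG.simples_eq s.unop).symm
  closure_monoid := by
    have h : simples P.op (MulOpposite.op Δ) = MulOpposite.unop ⁻¹' simples P Δ :=
      Set.ext fun s => (Set.ext_iff.1 hG.simples_eq s.unop).symm
    rw [h, ← Submonoid.op_closure, hG.closure_monoid]
  closure_group := by
    have h : simples P.op (MulOpposite.op Δ) = MulOpposite.unop ⁻¹' simples P Δ :=
      Set.ext fun s => (Set.ext_iff.1 hG.simples_eq s.unop).symm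
    rw [h, ← Subgroup.op_closure, hG.closure_group, Subgroup.op_top]
  norm_finite x hx hx1 := by
    obtain ⟨N, hN⟩ := hG.norm_finite x.unop hx (by simpa using hx1)
    refine ⟨N, fun l hl hlx => ?_⟩
    have := hN (l.map unop).reverse (by
      intro a ha
      rw [List.mem_reverse, List.mem_map] at ha
      obtain ⟨b, hb, rfl⟩ := ha
      exact ⟨(hl b hb).1, by simpa using (hl b hb).2⟩)
      (by rw [← unop_list_prod, hlx])
    simpa using this

theorem op_supremum_le_iff (hG : IsGarsideStructure P Δ) (hΔ : Δ ≠ 1) {g : G} {s : ℤ} :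
    supremum P.op (.op Δ) (.op g) ≤ s ↔ supremum P Δ g ≤ s := by
  rw [hG.op.supremum_le_iff (by simpa using hΔ), hG.supremum_le_iff hΔ]
  exact hG.zpow_mul_mem_iff s

theorem isProperSimple_op_iff (hG : IsGarsideStructure P Δ) {s : G} :
    IsProperSimple P.op (.op Δ) (.op s) ↔ IsProperSimple P Δ s := by
  have h := Set.ext_iff.1 hG.simples_eq s
  refine and_congr h.symm (and_congr ?_ ?_) <;> simp

theorem isChain_leftWeighted_op {l : List G} (hc : l.IsChain (RightWeighted P Δ)) :
    (l.map MulOpposite.op).reverse.IsChain (LeftWeighted P.op (MulOpposite.op Δ)) := by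
  rw [List.isChain_reverse, List.isChain_map]
  exact hc.imp fun a b h => ⟨h.1, h.2.1, fun c => h.2.2 c.unop⟩

theorem length_le_supremum_prod_of_rightWeighted (hG : IsGarsideStructure P Δ) (hΔ : Δ ≠ 1)
    {l : List G} (hl : ∀ s ∈ l, IsProperSimple P Δ s) (hc : l.IsChain (RightWeighted P Δ)) :
    (l.length : ℤ) ≤ supremum P Δ l.prod := by
  have := hG.op.length_le_supremum_prod (by simpa using hΔ) (l := (l.map MulOpposite.op).reverse)
    (by simpa [hG.isProperSimple_op_iff] using hl) (isChain_leftWeighted_op hc)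
  rw [← op_list_prod, List.length_reverse, List.length_map] at this
  exact this.trans ((hG.op_supremum_le_iff hΔ).2 le_rfl)

/-- In a right-weighted product of simple elements, the last factor is the greatest common suffix
with `Δ`. -/
theorem isSuffix_getLast_of_isChain (hG : IsGarsideStructure P Δ) {l : List G} (hne : l ≠ [])
    (hl : ∀ s ∈ l, IsProperSimple P Δ s) (hc : l.IsChain (RightWeighted P Δ)) {c : G}
    (h₁ : IsSuffix P c l.prod) (h₂ : IsSuffix P c Δ) : IsSuffix P c (l.getLast hne) := by
  obtain ⟨l, t, rfl⟩ := (List.eq_nil_or_concat' l).resolve_left hne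
  have hl' := isChain_leftWeighted_op hc
  rw [List.map_append, List.reverse_append] at hl'
  rw [List.getLast_append_singleton]
  refine hG.op.isPrefix_head_of_isChain (c := .op c) ?_ hl' ?_ h₂
  · simpa [hG.isProperSimple_op_iff, or_imp, forall_and, and_comm] using hl
  · have h : IsPrefix P.op (.op c) (.op (l ++ [t]).prod) := h₁
    rwa [op_list_prod, List.map_append, List.reverse_append] at h

end IsGarsideStructure

end Opposite

/-! ### The metric of the graph and its preferred paths -/

theorem vertex_eq_iff {g h : G} : vertex Δ g = vertex Δ h ↔ ∃ n : ℤ, h = g * Δ ^ n := by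
  unfold vertex
  rw [QuotientGroup.eq, Subgroup.mem_zpowers_iff]
  simp only [eq_inv_mul_iff_mul_eq, eq_comm]

theorem vertex_mul_zpow (g : G) (n : ℤ) : vertex Δ (g * Δ ^ n) = vertex Δ g :=
  (vertex_eq_iff.2 ⟨n, rfl⟩).symm

theorem exists_eq_vertex (v : Vertex Δ) : ∃ g, v = vertex Δ g :=
  let ⟨g, hg⟩ := QuotientGroup.mk_surjective v
  ⟨g, hg.symm⟩

namespace IsGarsideStructure

theorem canonicalLength_congr (hG : IsGarsideStructure P Δ) (hΔ : Δ ≠ 1) {g g' h h' : G}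
    (hg : vertex Δ g = vertex Δ g') (hh : vertex Δ h = vertex Δ h') :
    canonicalLength P Δ (g⁻¹ * h) = canonicalLength P Δ (g'⁻¹ * h') := by
  obtain ⟨n, rfl⟩ := vertex_eq_iff.1 hg
  obtain ⟨m, rfl⟩ := vertex_eq_iff.1 hh
  rw [mul_inv_rev, mul_assoc, ← mul_assoc g⁻¹, ← zpow_neg, hG.canonicalLength_zpow_mul hΔ,
    hG.canonicalLength_mul_zpow hΔ]

theorem isProperSimple_conj (hG : IsGarsideStructure P Δ) {s : G} (hs : IsProperSimple P Δ s)
    (n : ℤ) : IsProperSimple P Δ (Δ ^ n * s * Δ ^ (-n)) := by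
  refine ⟨⟨hG.zpow_conj_mem hs.1.1 n, ?_⟩, ?_, ?_⟩
  · rw [IsPrefix]
    convert hG.zpow_conj_mem hs.1.2 n using 1
    group
  · intro h
    refine hs.2.1 ?_
    rwa [zpow_neg, mul_inv_eq_one, mul_eq_left] at h
  · intro h
    refine hs.2.2 ?_
    rwa [zpow_neg, mul_inv_eq_iff_eq_mul, (Commute.refl Δ).zpow_right n |>.eq,
      mul_right_inj] at h

theorem adj_vertex_mul (hG : IsGarsideStructure P Δ) (hΔ : Δ ≠ 1) (g : G) {s : G}
    (hs : IsProperSimple P Δ s) : (graphX P Δ).Adj (vertex Δ g) (vertex Δ (g * s)) := by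
  rw [graphX, SimpleGraph.fromRel_adj]
  constructor
  · intro h
    obtain ⟨n, hn⟩ := vertex_eq_iff.1 h
    rw [mul_right_inj] at hn
    have := (hG.isProperSimple_iff hΔ).1 hs
    rw [hn, hG.infimum_zpow hΔ, hG.supremum_zpow hΔ] at this
    lia
  · refine Or.inl ⟨g, _, hG.isProperSimple_conj hs (infimum P Δ g), rfl, ?_⟩
    refine vertex_eq_iff.2 ⟨-infimum P Δ g, ?_⟩
    rw [rep]
    group

theorem exists_walk_of_list (hG : IsGarsideStructure P Δ) (hΔ : Δ ≠ 1) {g : G} {l : List G}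
    (hl : ∀ s ∈ l, IsProperSimple P Δ s) {v : Vertex Δ} (hv : vertex Δ (g * l.prod) = v) :
    ∃ p : (graphX P Δ).Walk (vertex Δ g) v, p.length = l.length := by
  induction l generalizing g with
  | nil =>
    rw [List.prod_nil, mul_one] at hv
    exact ⟨.copy .nil rfl hv, by simp⟩
  | cons s l ih =>
    rw [List.forall_mem_cons] at hl
    rw [List.prod_cons, ← mul_assoc] at hv
    obtain ⟨p, hp⟩ := ih hl.2 hv
    exact ⟨.cons (hG.adj_vertex_mul hΔ g hl.1) p, by simp [hp]⟩

theorem canonicalLength_le_one_of_adj (hG : IsGarsideStructure P Δ) (hΔ : Δ ≠ 1) {g h : G}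
    (hadj : (graphX P Δ).Adj (vertex Δ g) (vertex Δ h)) : canonicalLength P Δ (g⁻¹ * h) ≤ 1 := by
  have key : ∀ a b : G, (∃ g s : G, IsProperSimple P Δ s ∧ vertex Δ a = vertex Δ g ∧
      vertex Δ b = vertex Δ (rep P Δ g * s)) → canonicalLength P Δ (a⁻¹ * b) ≤ 1 := by
    rintro a b ⟨g, s, hs, ha, hb⟩
    rw [← vertex_mul_zpow g (-infimum P Δ g)] at ha
    rw [hG.canonicalLength_congr hΔ ha hb, rep, inv_mul_cancel_left, canonicalLength]
    have := (hG.isProperSimple_iff hΔ).1 hs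
    lia
  rw [graphX, SimpleGraph.fromRel_adj] at hadj
  rcases hadj.2 with h | h
  · exact key _ _ h
  · rw [← hG.canonicalLength_inv hΔ, mul_inv_rev, inv_inv]
    exact key _ _ h

theorem canonicalLength_le_length (hG : IsGarsideStructure P Δ) (hΔ : Δ ≠ 1) {u v : Vertex Δ}
    (p : (graphX P Δ).Walk u v) {g h : G} (hu : u = vertex Δ g) (hv : v = vertex Δ h) :
    canonicalLength P Δ (g⁻¹ * h) ≤ p.length := by
  induction p generalizing g with
  | nil =>
    rw [hG.canonicalLength_congr hΔ (hu.symm.trans hv) rfl, inv_mul_cancel,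
      hG.canonicalLength_one hΔ]
    simp
  | @cons a b c hadj p ih =>
    obtain ⟨k, rfl⟩ := exists_eq_vertex b
    subst hu
    have h₁ := ih rfl hv
    have h₂ := hG.canonicalLength_le_one_of_adj hΔ hadj
    have h₃ := hG.canonicalLength_mul_le hΔ (g⁻¹ * k) (k⁻¹ * h)
    rw [mul_assoc, mul_inv_cancel_left] at h₃
    rw [SimpleGraph.Walk.length_cons]
    push_cast
    lia

theorem infimum_rep (hG : IsGarsideStructure P Δ) (hΔ : Δ ≠ 1) (g : G) :
    infimum P Δ (rep P Δ g) = 0 := by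
  rw [rep, hG.infimum_mul_zpow hΔ]
  lia

theorem supremum_rep (hG : IsGarsideStructure P Δ) (hΔ : Δ ≠ 1) (g : G) :
    supremum P Δ (rep P Δ g) = canonicalLength P Δ g := by
  rw [rep, hG.supremum_mul_zpow hΔ, canonicalLength]
  lia

/-- The graph metric is given by the canonical length: normal forms are walks, and crossing an
edge changes the canonical length by at most one. -/
theorem distX_vertex (hG : IsGarsideStructure P Δ) (hΔ : Δ ≠ 1) (g h : G) :
    distX P Δ (vertex Δ g) (vertex Δ h) = canonicalLength P Δ (g⁻¹ * h) := by
  obtain ⟨n, hn⟩ := Int.eq_ofNat_of_zero_le (hG.canonicalLength_nonneg hΔ (g⁻¹ * h))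
  have hi := hG.infimum_rep hΔ (g⁻¹ * h)
  have hs := (hG.supremum_rep hΔ (g⁻¹ * h)).trans hn
  obtain ⟨h₁, h₂, -⟩ := hG.isLeftNormalForm_normalFormList hΔ hi hs
  have hv : vertex Δ (g * (normalFormList P Δ (rep P Δ (g⁻¹ * h)) n).prod) = vertex Δ h := by
    rw [hi, zpow_zero, one_mul] at h₁
    rw [← h₁, rep, ← mul_assoc, vertex_mul_zpow, mul_inv_cancel_left]
  have hl : (normalFormList P Δ (rep P Δ (g⁻¹ * h)) n).length = n := by simp [normalFormList]
  obtain ⟨p, hp⟩ := hG.exists_walk_of_list hΔ h₂ hv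
  obtain ⟨q, hq⟩ := p.reachable.exists_walk_length_eq_dist
  have h₃ := SimpleGraph.dist_le p
  have h₄ := hG.canonicalLength_le_length hΔ q rfl rfl
  rw [distX, hn, ← hq]
  have : q.length = n := by lia
  simp [this]

theorem distX_mul_left (hG : IsGarsideStructure P Δ) (hΔ : Δ ≠ 1) (a g h : G) :
    distX P Δ (vertex Δ (a * g)) (vertex Δ (a * h)) = distX P Δ (vertex Δ g) (vertex Δ h) := by
  rw [hG.distX_vertex hΔ, hG.distX_vertex hΔ]
  simp [mul_assoc]

theorem distX_triangle (hG : IsGarsideStructure P Δ) (hΔ : Δ ≠ 1) (u v w : Vertex Δ) :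
    distX P Δ u w ≤ distX P Δ u v + distX P Δ v w := by
  obtain ⟨a, rfl⟩ := exists_eq_vertex u
  obtain ⟨b, rfl⟩ := exists_eq_vertex v
  obtain ⟨c, rfl⟩ := exists_eq_vertex w
  rw [hG.distX_vertex hΔ, hG.distX_vertex hΔ, hG.distX_vertex hΔ]
  have := hG.canonicalLength_mul_le hΔ (a⁻¹ * b) (b⁻¹ * c)
  rw [mul_assoc, mul_inv_cancel_left] at this
  exact_mod_cast this

/-- The preferred path from `g` to `h` passes through all truncations of any positive
representative of `g⁻¹ h ⟨Δ⟩` with infimum `0`. -/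
theorem vertex_mul_mem_preferredPath (hG : IsGarsideStructure P Δ) (hΔ : Δ ≠ 1) {g h w : G}
    {n : ℤ} (hn : 0 ≤ n)
    (hw : IsGreatestCommonPrefix P (rep P Δ (g⁻¹ * h)) (Δ ^ n) w) :
    vertex Δ (g * w) ∈ preferredPath P Δ g h := by
  set a := -infimum P Δ g with ha
  set z := rep P Δ ((rep P Δ g)⁻¹ * h) with hz
  have hrep : rep P Δ g = g * Δ ^ a := rfl
  have hzw : z = Δ ^ (-a) * rep P Δ (g⁻¹ * h) * Δ ^ a := by
    have hb : infimum P Δ ((rep P Δ g)⁻¹ * h) = infimum P Δ (g⁻¹ * h) - a := by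
      have h₁ := hG.infimum_mul_le hΔ (Δ ^ (-a)) (g⁻¹ * h)
      have h₂ := hG.infimum_mul_le hΔ (Δ ^ a) (Δ ^ (-a) * (g⁻¹ * h))
      rw [hG.infimum_zpow hΔ] at h₁ h₂
      rw [← mul_assoc (Δ ^ a), ← zpow_add, add_neg_cancel, zpow_zero, one_mul] at h₂
      rw [hrep, mul_inv_rev, ← zpow_neg, mul_assoc]
      lia
    rw [hz, rep, hb, hrep, rep]
    group
  have hi : infimum P Δ z = 0 := hG.infimum_rep hΔ _
  obtain ⟨N, hN⟩ := Int.eq_ofNat_of_zero_le (hG.canonicalLength_nonneg hΔ ((rep P Δ g)⁻¹ * h))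
  have hs : supremum P Δ z = N := (hG.supremum_rep hΔ _).trans hN
  have hzP : z ∈ P := (hG.infimum_nonneg_iff hΔ).1 hi.ge
  have hw' : trunc P Δ z n = Δ ^ (-a) * w * Δ ^ a := by
    refine hG.isGreatestCommonPrefix_unique (hG.trunc_spec z n) ⟨?_, ?_, fun c h₁ h₂ => ?_⟩
    · rw [hzw, hG.isPrefix_mul_zpow_iff, isPrefix_mul_left_iff]
      exact hw.1
    · rw [show Δ ^ n = Δ ^ (-a) * Δ ^ n * Δ ^ a by group, hG.isPrefix_mul_zpow_iff,
        isPrefix_mul_left_iff]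
      exact hw.2.1
    · rw [show c = Δ ^ (-a) * (Δ ^ a * c * Δ ^ (-a)) * Δ ^ a by group] at h₁ h₂ ⊢
      rw [hzw, hG.isPrefix_mul_zpow_iff, isPrefix_mul_left_iff] at h₁
      rw [show Δ ^ n = Δ ^ (-a) * Δ ^ n * Δ ^ a by group, hG.isPrefix_mul_zpow_iff,
        isPrefix_mul_left_iff] at h₂
      rw [hG.isPrefix_mul_zpow_iff, isPrefix_mul_left_iff]
      exact hw.2.2 _ h₁ h₂
  lift n to ℕ using hn
  have hmin : trunc P Δ z (min n N : ℕ) = trunc P Δ z n := by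
    rcases le_total n N with h | h
    · rw [min_eq_left h]
    · rw [min_eq_right h, hG.trunc_of_supremum_le hΔ hs.le,
        hG.trunc_of_supremum_le hΔ (hs.le.trans (by exact_mod_cast h))]
  refine ⟨normalFormList P Δ z N, hG.isLeftNormalForm_normalFormList hΔ hi hs, min n N,
    by simp [normalFormList], ?_⟩
  rw [take_normalFormList z (min_le_right n N), hG.normalFormList_prod hzP, hmin, hw', hrep,
    ← vertex_mul_zpow _ a]
  congr 1
  group

/-- Preferred paths are geodesics. -/
theorem distX_add_distX_le_of_mem_preferredPath (hG : IsGarsideStructure P Δ) (hΔ : Δ ≠ 1)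
    {g h : G} {v : Vertex Δ} (hv : v ∈ preferredPath P Δ g h) :
    distX P Δ (vertex Δ g) v + distX P Δ v (vertex Δ h) ≤ distX P Δ (vertex Δ g) (vertex Δ h) := by
  obtain ⟨l, ⟨hl, hp, hc⟩, i, hi, rfl⟩ := hv
  set z := rep P Δ ((rep P Δ g)⁻¹ * h) with hz
  have hiz : infimum P Δ z = 0 := hG.infimum_rep hΔ _
  rw [hiz, zpow_zero, one_mul] at hl
  have hg : vertex Δ g = vertex Δ (rep P Δ g) := (vertex_mul_zpow g _).symm
  have hh : vertex Δ h = vertex Δ (rep P Δ g * z) := by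
    have hz' : z = (rep P Δ g)⁻¹ * h * Δ ^ (-infimum P Δ ((rep P Δ g)⁻¹ * h)) := rfl
    rw [hz', ← mul_assoc, vertex_mul_zpow, mul_inv_cancel_left]
  have h₁ := hG.canonicalLength_prod_le hΔ (l := l.take i)
    fun s hs => hp s (List.mem_of_mem_take hs)
  have h₂ := hG.canonicalLength_prod_le hΔ (l := l.drop i)
    fun s hs => hp s (List.mem_of_mem_drop hs)
  have h₃ := hG.length_le_supremum_prod hΔ hp hc
  rw [hg, hh, hG.distX_vertex hΔ, hG.distX_vertex hΔ, hG.distX_vertex hΔ]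
  have h₄ : (rep P Δ g * (l.take i).prod)⁻¹ * (rep P Δ g * z) = (l.drop i).prod := by
    rw [hl, ← List.prod_take_mul_prod_drop l i]
    group
  rw [h₄, inv_mul_cancel_left, inv_mul_cancel_left]
  have h₅ : canonicalLength P Δ z = supremum P Δ l.prod := by
    rw [canonicalLength, hiz, sub_zero, hl]
  rw [List.length_take] at h₁
  rw [List.length_drop] at h₂
  have : canonicalLength P Δ (l.take i).prod + canonicalLength P Δ (l.drop i).prod
      ≤ canonicalLength P Δ z := by lia
  exact_mod_cast this

end IsGarsideStructure

/-! ### Quasi-geodesics with one corner -/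

/-- Let two geodesics meet at a corner. If every distance between a point of the first and a point
of the second is at least the distance of either point to the corner, then it is at least half of
the length of the path between them, and the concatenation is a `(2, 0)`-quasi-geodesic. -/
theorem isQuasiGeodesic_concat {X : Type*} {d : X → X → ℝ} (hsymm : ∀ a b, d a b = d b a)
    (htri : ∀ a b c, d a c ≤ d a b + d b c) {N n : ℕ} {p q : ℕ → X} (hpq : p N = q 0)
    (hp : ∀ s t, s ≤ t → t ≤ N → d (p s) (p t) = t - s)
    (hq : ∀ s t, s ≤ t → t ≤ n → d (q s) (q t) = t - s)
    (hmix : ∀ s ≤ N, ∀ t ≤ n, (N : ℝ) - s ≤ d (p s) (q t) ∧ (t : ℝ) ≤ d (p s) (q t)) :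
    IsQuasiGeodesic d 2 0 (N + n) fun s => if s ≤ N then p s else q (s - N) := by
  set c : ℕ → X := fun s => if s ≤ N then p s else q (s - N) with hc
  have key : ∀ s t, s ≤ t → t ≤ N + n →
      ((t : ℝ) - s) / 2 ≤ d (c s) (c t) ∧ d (c s) (c t) ≤ t - s := by
    intro s t hst ht
    have hst' : (s : ℝ) ≤ t := by exact_mod_cast hst
    by_cases htN : t ≤ N
    · have h : d (c s) (c t) = t - s := by
        simp only [hc, htN, hst.trans htN, if_true]
        exact hp s t hst htN
      rw [h]
      constructor <;> linarith
    · by_cases hsN : s ≤ N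
      · obtain ⟨u, rfl⟩ := Nat.exists_eq_add_of_le (le_of_not_ge htN)
        have h : d (c s) (c (N + u)) = d (p s) (q u) := by
          simp only [hc, htN, hsN, if_true, if_false, Nat.add_sub_cancel_left]
        obtain ⟨h₁, h₂⟩ := hmix s hsN u (by lia)
        have h₃ := htri (p s) (p N) (q u)
        rw [hp s N hsN le_rfl, hpq, hq 0 u (by lia) (by lia)] at h₃
        rw [h]
        push_cast at h₃ ⊢
        constructor <;> linarith
      · obtain ⟨u, rfl⟩ := Nat.exists_eq_add_of_le (le_of_not_ge htN)
        obtain ⟨v, rfl⟩ := Nat.exists_eq_add_of_le (le_of_not_ge hsN)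
        have h : d (c (N + v)) (c (N + u)) = u - v := by
          simp only [hc, htN, hsN, if_false, Nat.add_sub_cancel_left]
          exact hq v u (by lia) (by lia)
        rw [h]
        push_cast at hst' ⊢
        constructor <;> linarith
  intro s hs t ht
  rcases le_total s t with hst | hst
  · obtain ⟨h₁, h₂⟩ := key s t hst ht
    have hst' : (s : ℝ) ≤ t := by exact_mod_cast hst
    rw [abs_of_nonpos (by linarith)]
    constructor <;> linarith
  · obtain ⟨h₁, h₂⟩ := key t s hst hs
    have hst' : (t : ℝ) ≤ s := by exact_mod_cast hst
    rw [hsymm, abs_of_nonneg (by linarith)]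
    constructor <;> linarith

/-- The corner of a concatenation of two geodesics as in `isQuasiGeodesic_concat`, with both ends
on a Morse axis, is close to the axis. -/
theorem IsMorseConstant.exists_corner_le {X : Type*} {d : X → X → ℝ} {γ : ℤ → X} {M : ℝ}
    (hM : IsMorseConstant d γ 2 0 M) (hsymm : ∀ a b, d a b = d b a)
    (htri : ∀ a b c, d a c ≤ d a b + d b c) {N n : ℕ} {p q : ℕ → X} (hpq : p N = q 0)
    (hp : ∀ s t, s ≤ t → t ≤ N → d (p s) (p t) = t - s)
    (hq : ∀ s t, s ≤ t → t ≤ n → d (q s) (q t) = t - s)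
    (hmix : ∀ s ≤ N, ∀ t ≤ n, (N : ℝ) - s ≤ d (p s) (q t) ∧ (t : ℝ) ≤ d (p s) (q t))
    (h0 : ∃ i, p 0 = γ i) (hn : ∃ j, q n = γ j) : ∃ k, d (p N) (γ k) ≤ M := by
  have h := hM _ _ (isQuasiGeodesic_concat hsymm htri hpq hp hq hmix) (by simpa using h0) (by
    rcases Nat.eq_zero_or_pos n with rfl | hpos
    · simpa [hpq] using hn
    · simpa [hpos.ne'] using hn) N (by lia)
  simpa using h

theorem distX_symm (u v : Vertex Δ) : distX P Δ u v = distX P Δ v u := by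
  rw [distX, distX, SimpleGraph.dist_comm]

namespace IsGarsideStructure

theorem distX_mul_trunc (hG : IsGarsideStructure P Δ) (hΔ : Δ ≠ 1) (a : G) {z : G}
    (hz : infimum P Δ z = 0) {s t : ℤ} (hs : 0 ≤ s) (hst : s ≤ t) (ht : t ≤ supremum P Δ z) :
    distX P Δ (vertex Δ (a * trunc P Δ z s)) (vertex Δ (a * trunc P Δ z t)) = t - s := by
  rw [hG.distX_mul_left hΔ, hG.distX_vertex hΔ, canonicalLength,
    hG.infimum_inv_trunc_mul_trunc hΔ hz hs hst, hG.supremum_inv_trunc_mul_trunc hΔ hst ht]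
  push_cast
  ring

/-- If `b ≼ u` are positive and `u` has infimum `0`, then going from `1` up to `b` and from there
up to `u` along normal forms is a `(2, 0)`-quasi-geodesic. -/
theorem exists_distX_le_of_isPrefix (hG : IsGarsideStructure P Δ) (hΔ : Δ ≠ 1)
    {γ : ℤ → Vertex Δ} {M : ℝ} (hM : IsMorseConstant (distX P Δ) γ 2 0 M) {b u : G}
    (hb : b ∈ P) (hbu : IsPrefix P b u) (hu : infimum P Δ u = 0) (h0 : ∃ i, vertex Δ 1 = γ i)
    (h1 : ∃ j, vertex Δ u = γ j) : ∃ k, distX P Δ (vertex Δ b) (γ k) ≤ M := by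
  set c := b⁻¹ * u with hc
  have hbc : b * c = u := mul_inv_cancel_left b u
  have hcP : c ∈ P := hbu
  have hib : infimum P Δ b = 0 :=
    le_antisymm ((hG.infimum_mono hΔ hbu).trans hu.le) ((hG.infimum_nonneg_iff hΔ).2 hb)
  have hic : infimum P Δ c = 0 := by
    have h₁ := hG.infimum_mul_le hΔ b c
    have h₂ := (hG.infimum_nonneg_iff hΔ).2 hcP
    rw [hbc] at h₁
    lia
  have hsb : ∃ N : ℕ, supremum P Δ b = N :=
    Int.eq_ofNat_of_zero_le (hib.ge.trans (hG.infimum_le_supremum hΔ b))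
  have hsc : ∃ n : ℕ, supremum P Δ c = n :=
    Int.eq_ofNat_of_zero_le (hic.ge.trans (hG.infimum_le_supremum hΔ c))
  obtain ⟨N, hN⟩ := hsb
  obtain ⟨n, hn⟩ := hsc
  have hbN : trunc P Δ b N = b := hG.trunc_of_supremum_le hΔ hN.le
  have hcn : trunc P Δ c n = c := hG.trunc_of_supremum_le hΔ hn.le
  have key := hM.exists_corner_le (p := fun s : ℕ => vertex Δ (1 * trunc P Δ b s))
    (q := fun t : ℕ => vertex Δ (b * trunc P Δ c t)) (N := N) (n := n) distX_symm
    (hG.distX_triangle hΔ)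
    (by simp [hbN, hG.trunc_zero hcP])
    (fun s t hst ht => by
      simpa using hG.distX_mul_trunc hΔ 1 hib (s := s) (t := t) (by lia) (by lia) (by lia))
    (fun s t hst ht => by
      simpa using hG.distX_mul_trunc hΔ b hic (s := s) (t := t) (by lia) (by lia) (by lia))
    (fun s hs t ht => ?_) (by simpa [hG.trunc_zero hb] using h0) (by simpa [hcn, hbc] using h1)
  · simpa [hbN] using key
  · rw [one_mul, hG.distX_vertex hΔ]
    set v := (trunc P Δ b s)⁻¹ * (b * trunc P Δ c t) with hv
    have hct : trunc P Δ c t ∈ P := hG.trunc_mem hcP (by lia)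
    have h₁ : (N : ℤ) - s ≤ supremum P Δ v := by
      rw [← hG.supremum_inv_trunc_mul_trunc hΔ (z := b) (s := s) (t := N) (by lia) hN.ge, hbN, hv,
        ← mul_assoc]
      exact hG.supremum_mono hΔ (isPrefix_mul_self hct)
    have h₂ : (t : ℤ) ≤ supremum P Δ v := by
      have h₃ := hG.supremum_inv_trunc_mul_trunc hΔ (z := c) (s := 0) (t := t) (by lia) (by lia)
      rw [hG.trunc_zero hcP, inv_one, one_mul] at h₃
      have h₄ := hG.supremum_mul_le hΔ ((trunc P Δ b s)⁻¹ * b)⁻¹ v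
      have h₅ : 0 ≤ infimum P Δ ((trunc P Δ b s)⁻¹ * b) :=
        (hG.infimum_nonneg_iff hΔ).2 (hG.trunc_spec b s).1
      have h₆ : ((trunc P Δ b s)⁻¹ * b)⁻¹ * v = trunc P Δ c t := by
        rw [hv]
        group
      rw [h₆, hG.supremum_inv hΔ, h₃] at h₄
      lia
    have h₆ : infimum P Δ v ≤ 0 := by
      have h₇ := hG.infimum_mul_le hΔ (trunc P Δ b s) v
      have h₈ := (hG.infimum_nonneg_iff hΔ).2 (hG.trunc_mem hb (s := s) (by lia))
      have h₉ : infimum P Δ (b * trunc P Δ c t) ≤ infimum P Δ u := by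
        rw [← hbc]
        exact hG.infimum_mono hΔ ((isPrefix_mul_left_iff b).2 (hG.trunc_spec c t).1)
      rw [hv, mul_inv_cancel_left, ← hv] at h₇
      lia
    unfold canonicalLength
    constructor
    · have : (N : ℤ) - s ≤ supremum P Δ v - infimum P Δ v := by lia
      exact_mod_cast this
    · have : (t : ℤ) ≤ supremum P Δ v - infimum P Δ v := by lia
      exact_mod_cast this

/-- If `u ≼ w` are positive with the same supremum and `w` has infimum `0`, then going from `1` up
to `w` and from there back down to `u` along normal forms is a `(2, 0)`-quasi-geodesic. -/
theorem exists_distX_le_of_supremum_eq (hG : IsGarsideStructure P Δ) (hΔ : Δ ≠ 1)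
    {γ : ℤ → Vertex Δ} {M : ℝ} (hM : IsMorseConstant (distX P Δ) γ 2 0 M) {u w : G}
    (hu : u ∈ P) (huw : IsPrefix P u w) (hw : infimum P Δ w = 0)
    (hsup : supremum P Δ u = supremum P Δ w) (h0 : ∃ i, vertex Δ 1 = γ i)
    (h1 : ∃ j, vertex Δ u = γ j) : ∃ k, distX P Δ (vertex Δ w) (γ k) ≤ M := by
  set a := u⁻¹ * w with ha
  have hua : u * a = w := mul_inv_cancel_left u w
  have haP : a ∈ P := huw
  have hwP : w ∈ P := (hG.infimum_nonneg_iff hΔ).1 hw.ge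
  have hia : infimum P Δ a = 0 := by
    have h₁ := hG.infimum_mul_le hΔ u a
    have h₂ := (hG.infimum_nonneg_iff hΔ).2 haP
    have h₃ := (hG.infimum_nonneg_iff hΔ).2 hu
    rw [hua] at h₁
    lia
  have hsw : ∃ N : ℕ, supremum P Δ w = N :=
    Int.eq_ofNat_of_zero_le (hw.ge.trans (hG.infimum_le_supremum hΔ w))
  have hsa : ∃ n : ℕ, supremum P Δ a = n :=
    Int.eq_ofNat_of_zero_le (hia.ge.trans (hG.infimum_le_supremum hΔ a))
  obtain ⟨N, hN⟩ := hsw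
  obtain ⟨n, hn⟩ := hsa
  have hwN : trunc P Δ w N = w := hG.trunc_of_supremum_le hΔ hN.le
  have han : trunc P Δ a n = a := hG.trunc_of_supremum_le hΔ hn.le
  have key := hM.exists_corner_le (p := fun s : ℕ => vertex Δ (1 * trunc P Δ w s))
    (q := fun t : ℕ => vertex Δ (u * trunc P Δ a (n - t))) (N := N) (n := n) distX_symm
    (hG.distX_triangle hΔ)
    (by simp [hwN, han, hua])
    (fun s t hst ht => by
      simpa using hG.distX_mul_trunc hΔ 1 hw (s := s) (t := t) (by lia) (by lia) (by lia))
    (fun s t hst ht => by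
      rw [distX_symm, hG.distX_mul_trunc hΔ u hia (by lia) (by lia) (by lia)]
      push_cast
      ring)
    (fun s hs t ht => ?_) (by simpa [hG.trunc_zero hwP] using h0)
    (by simpa [hG.trunc_zero haP] using h1)
  · simpa [hwN] using key
  · rw [one_mul, hG.distX_vertex hΔ]
    set y := u * trunc P Δ a (n - t) with hy
    set v := (trunc P Δ w s)⁻¹ * y with hv
    have hwv : trunc P Δ w s * v = y := mul_inv_cancel_left _ _
    have hyw : y⁻¹ * w = (trunc P Δ a (n - t))⁻¹ * a := by
      rw [hy, ← hua]
      group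
    have h₁ : (N : ℤ) - s ≤ supremum P Δ v := by
      have h₃ : supremum P Δ u ≤ supremum P Δ y :=
        hG.supremum_mono hΔ (isPrefix_mul_self (hG.trunc_mem haP (by lia)))
      have h₄ := hG.supremum_trunc_le hΔ w s
      have h₅ := hG.supremum_mul_le hΔ (trunc P Δ w s) v
      rw [hwv] at h₅
      lia
    -- `supremum v⁻¹ = -infimum v`, and `v⁻¹` leads from `y` back to the truncation of `w`
    have h₂ : (t : ℤ) ≤ -infimum P Δ v + (N - s) := by
      have h₃ := hG.supremum_inv_trunc_mul_trunc hΔ (z := a) (s := n - t) (t := n) (by lia)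
        (by lia)
      have h₄ := hG.supremum_inv_trunc_mul_trunc hΔ (z := w) (s := s) (t := N) (by lia) (by lia)
      have h₅ := hG.supremum_mul_le hΔ v⁻¹ ((trunc P Δ w s)⁻¹ * w)
      have h₆ : v⁻¹ * ((trunc P Δ w s)⁻¹ * w) = y⁻¹ * w := by
        rw [hv]
        group
      rw [han] at h₃
      rw [hwN] at h₄
      rw [h₆, hyw, hG.supremum_inv hΔ, h₃, h₄] at h₅
      lia
    have h₆ : infimum P Δ v ≤ 0 := by
      have h₇ := hG.infimum_mul_le hΔ (trunc P Δ w s) v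
      have h₈ := (hG.infimum_nonneg_iff hΔ).2 (hG.trunc_mem hwP (s := s) (by lia))
      have h₉ : infimum P Δ y ≤ infimum P Δ w := by
        rw [← hua]
        exact hG.infimum_mono hΔ ((isPrefix_mul_left_iff u).2 (hG.trunc_spec a _).1)
      rw [hwv] at h₇
      lia
    unfold canonicalLength
    constructor
    · have : (N : ℤ) - s ≤ supremum P Δ v - infimum P Δ v := by lia
      exact_mod_cast this
    · have : (t : ℤ) ≤ supremum P Δ v - infimum P Δ v := by lia
      exact_mod_cast this

end IsGarsideStructure

variable {x : G}

/-! ### Powers of a right-rigid element -/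

theorem IsProperSimple.delta_ne_one {s : G} (hG : IsGarsideStructure P Δ)
    (hs : IsProperSimple P Δ s) : Δ ≠ 1 := by
  rintro rfl
  exact hs.2.1 (hG.pointed s hs.1.1 (by simpa [IsPrefix] using hs.1.2))

theorem IsRightRigid.delta_ne_one (hG : IsGarsideStructure P Δ) (hrigid : IsRightRigid P Δ x) :
    Δ ≠ 1 := by
  obtain ⟨l, hl, ⟨-, hp, -⟩, -⟩ := hrigid
  exact (hp _ (List.head_mem hl)).delta_ne_one hG

/-- The powers of a right-rigid element with infimum `0` have right normal forms obtained by
repeating that of the element. -/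
theorem IsRightRigid.exists_list (hinf : infimum P Δ x = 0) (hrigid : IsRightRigid P Δ x) :
    ∃ l : List G, l ≠ [] ∧ l.prod = x ∧ (∀ s ∈ l, IsProperSimple P Δ s) ∧
      ∀ n : ℕ, (List.replicate n l).flatten.IsChain (RightWeighted P Δ) := by
  obtain ⟨l, hl, ⟨hx, hp, hc⟩, hr⟩ := hrigid
  rw [hinf, zpow_zero, mul_one] at hx
  rw [hinf] at hr
  simp only [neg_zero, zpow_zero, one_mul, mul_one] at hr
  refine ⟨l, hl, hx.symm, hp, fun n => ?_⟩
  have hne : [] ∉ List.replicate n l := fun h => hl (List.eq_of_mem_replicate h).symm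
  rw [List.isChain_flatten hne]
  refine ⟨fun l' h => List.eq_of_mem_replicate h ▸ hc, ?_⟩
  refine List.isChain_replicate_of_rel n fun a ha b hb => ?_
  rw [List.getLast?_eq_some_getLast hl, Option.mem_some_iff] at ha
  rw [List.head?_eq_some_head hl, Option.mem_some_iff] at hb
  subst ha hb
  exact ⟨hr.2.1, hr.1, fun c h₁ h₂ => hr.2.2 c h₂ h₁⟩

namespace IsGarsideStructure

theorem le_infimum_iff' (hG : IsGarsideStructure P Δ) (hΔ : Δ ≠ 1) {r : ℤ} {g : G} :
    r ≤ infimum P Δ g ↔ g * Δ ^ (-r) ∈ P := by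
  rw [hG.le_infimum_iff hΔ, IsPrefix, ← zpow_neg, hG.zpow_mul_mem_iff]

theorem mem_of_infimum_eq_zero (hG : IsGarsideStructure P Δ) (hΔ : Δ ≠ 1)
    (hinf : infimum P Δ x = 0) : x ∈ P :=
  (hG.infimum_nonneg_iff hΔ).1 hinf.ge

theorem infimum_le_infimum_mul (hG : IsGarsideStructure P Δ) (hΔ : Δ ≠ 1)
    (hinf : infimum P Δ x = 0) (g : G) : infimum P Δ g ≤ infimum P Δ (x * g) := by
  have := hG.infimum_mul_le hΔ x g
  lia

/-- Since the right normal form of `x * x` ends with the last factor of that of `x`, multiplying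
on the left by a second copy of `x` cannot create a factor `Δ` that the first copy does not. -/
theorem infimum_mul_mul (hG : IsGarsideStructure P Δ) (hinf : infimum P Δ x = 0)
    (hrigid : IsRightRigid P Δ x) {g : G} (h : infimum P Δ (x * g) = infimum P Δ g) :
    infimum P Δ (x * (x * g)) = infimum P Δ g := by
  have hΔ := hrigid.delta_ne_one hG
  obtain ⟨l, hl, rfl, hp, hc⟩ := hrigid.exists_list hinf
  refine le_antisymm ?_ (h ▸ hG.infimum_le_infimum_mul hΔ hinf _)
  by_contra! hlt
  have h₁ := (hG.le_infimum_iff' hΔ).1 (Int.add_one_le_of_lt hlt)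
  set y := g * Δ ^ (-infimum P Δ g) with hy
  have hyP : y ∈ P := (hG.le_infimum_iff' hΔ).1 le_rfl
  have hll : (l ++ l).IsChain (RightWeighted P Δ) := by simpa using hc 2
  -- the common suffix `Δ * y⁻¹` of `x * x` and `Δ` is a suffix of the last factor
  have key := hG.isSuffix_getLast_of_isChain (c := Δ * y⁻¹) (by simpa using hl)
    (fun s hs => hp s (by simpa using hs)) hll (by
      rw [List.prod_append, IsSuffix]
      convert h₁ using 1
      rw [hy]
      group) (by
      rw [IsSuffix]
      convert hG.zpow_conj_mem hyP 1 using 1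
      group)
  rw [List.getLast_append_right hl, IsSuffix] at key
  have hx : l.prod = l.dropLast.prod * l.getLast hl := by
    conv_lhs => rw [← List.dropLast_concat_getLast hl, List.prod_append, List.prod_singleton]
  have h₂ : infimum P Δ g + 1 ≤ infimum P Δ (l.prod * g) := by
    rw [hG.le_infimum_iff' hΔ]
    convert P.mul_mem (prod_mem fun s hs => hp s (List.mem_of_mem_dropLast hs)) key using 1
    rw [hx, hy]
    group
  lia

theorem infimum_pow_mul (hG : IsGarsideStructure P Δ) (hinf : infimum P Δ x = 0)
    (hrigid : IsRightRigid P Δ x) {g : G} (h : infimum P Δ (x * g) = infimum P Δ g) (n : ℕ) :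
    infimum P Δ (x ^ n * g) = infimum P Δ g := by
  induction n generalizing g with
  | zero => simp
  | succ n ih =>
    rw [pow_succ, mul_assoc, ih ((hG.infimum_mul_mul hinf hrigid h).trans h.symm), h]

theorem infimum_pow (hG : IsGarsideStructure P Δ) (hinf : infimum P Δ x = 0)
    (hrigid : IsRightRigid P Δ x) (n : ℕ) : infimum P Δ (x ^ n) = 0 := by
  have h1 : infimum P Δ 1 = 0 := by simpa using hG.infimum_zpow (hrigid.delta_ne_one hG) 0
  have := hG.infimum_pow_mul hinf hrigid (g := 1) (by rw [mul_one, hinf, h1]) n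
  rwa [mul_one, h1] at this

theorem supremum_pow (hG : IsGarsideStructure P Δ) (hinf : infimum P Δ x = 0)
    (hrigid : IsRightRigid P Δ x) (n : ℕ) :
    supremum P Δ (x ^ n) = n * canonicalLength P Δ x := by
  have hΔ := hrigid.delta_ne_one hG
  obtain ⟨l, hl, hx, hp, hc⟩ := hrigid.exists_list hinf
  have hflat : ∀ m : ℕ, supremum P Δ (x ^ m) = m * l.length := by
    intro m
    have hpm : ∀ s ∈ (List.replicate m l).flatten, IsProperSimple P Δ s := by
      intro s hs
      obtain ⟨l', hl', hs'⟩ := List.mem_flatten.1 hs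
      exact hp s (List.eq_of_mem_replicate hl' ▸ hs')
    have h₁ := hG.length_le_supremum_prod_of_rightWeighted hΔ hpm (hc m)
    have h₂ := hG.supremum_prod_le hΔ hpm
    have h₃ : (List.replicate m l).flatten.prod = x ^ m := by
      rw [List.prod_flatten, List.map_replicate, List.prod_replicate, hx]
    rw [h₃] at h₁ h₂
    rw [le_antisymm h₂ h₁]
    simp
  rw [hflat, canonicalLength, hinf, sub_zero]
  have := hflat 1
  rw [pow_one] at this
  simp [this]

theorem one_le_canonicalLength (hG : IsGarsideStructure P Δ) (hinf : infimum P Δ x = 0)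
    (hrigid : IsRightRigid P Δ x) : 1 ≤ canonicalLength P Δ x := by
  have hΔ := hrigid.delta_ne_one hG
  obtain ⟨l, hl, hx, hp, hc⟩ := hrigid.exists_list hinf
  have h₁ := hG.length_le_supremum_prod_of_rightWeighted hΔ hp (by simpa using hc 1)
  have h₂ := List.length_pos_iff.2 hl
  rw [canonicalLength, hinf, ← hx]
  lia

theorem canonicalLength_zpow (hG : IsGarsideStructure P Δ) (hinf : infimum P Δ x = 0)
    (hrigid : IsRightRigid P Δ x) (n : ℤ) :
    canonicalLength P Δ (x ^ n) = |n| * canonicalLength P Δ x := by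
  have hΔ := hrigid.delta_ne_one hG
  have key : ∀ m : ℕ, canonicalLength P Δ (x ^ m) = m * canonicalLength P Δ x := fun m => by
    rw [← hG.supremum_pow hinf hrigid, canonicalLength, hG.infimum_pow hinf hrigid, sub_zero]
  obtain ⟨m, rfl | rfl⟩ := n.eq_nat_or_neg
  · simp [key]
  · rw [zpow_neg, hG.canonicalLength_inv hΔ]
    simp [key]

/-! ### The projection to the axis -/

/-- Along the axis, `x` is a prefix of `rep (x ^ k * h)` exactly where the infimum of `x ^ k * h`
does not increase. -/
theorem mem_nonPrefixSet_iff (hG : IsGarsideStructure P Δ) (hΔ : Δ ≠ 1) {h : G} {k : ℤ} :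
    k ∈ nonPrefixSet P Δ x h ↔ infimum P Δ (x ^ (k - 1) * h) < infimum P Δ (x ^ k * h) := by
  rw [nonPrefixSet, Set.mem_ofPred_eq, IsPrefix, rep, ← not_le, not_iff_not,
    hG.le_infimum_iff' hΔ]
  suffices x⁻¹ * (x ^ k * h * Δ ^ (-infimum P Δ (x ^ k * h))) =
      x ^ (k - 1) * h * Δ ^ (-infimum P Δ (x ^ k * h)) by rw [this]
  group

theorem infimum_eq_of_notMem (hG : IsGarsideStructure P Δ) (hinf : infimum P Δ x = 0)
    (hrigid : IsRightRigid P Δ x) {h : G} {k : ℤ} (hk : k ∉ nonPrefixSet P Δ x h) {j : ℤ}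
    (hj : k - 1 ≤ j) : infimum P Δ (x ^ j * h) = infimum P Δ (x ^ (k - 1) * h) := by
  have hΔ := hrigid.delta_ne_one hG
  rw [hG.mem_nonPrefixSet_iff hΔ, not_lt] at hk
  have hxk : x ^ k * h = x * (x ^ (k - 1) * h) := by group
  obtain ⟨n, hn⟩ := Int.eq_ofNat_of_zero_le (sub_nonneg.2 hj)
  have h₁ := hG.infimum_pow_mul hinf hrigid (g := x ^ (k - 1) * h)
    (le_antisymm (hxk ▸ hk) (hG.infimum_le_infimum_mul hΔ hinf _)) n
  rw [← h₁, ← mul_assoc, ← zpow_natCast, ← zpow_add]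
  congr 3
  lia

theorem notMem_nonPrefixSet_of_le (hG : IsGarsideStructure P Δ) (hinf : infimum P Δ x = 0)
    (hrigid : IsRightRigid P Δ x) {h : G} {k : ℤ} (hk : k ∉ nonPrefixSet P Δ x h) {j : ℤ}
    (hj : k ≤ j) : j ∉ nonPrefixSet P Δ x h := by
  rw [hG.mem_nonPrefixSet_iff (hrigid.delta_ne_one hG),
    hG.infimum_eq_of_notMem hinf hrigid hk (j := j) (by lia),
    hG.infimum_eq_of_notMem hinf hrigid hk (j := j - 1) (by lia)]
  exact lt_irrefl _

theorem infimum_zpow_sub_le (hG : IsGarsideStructure P Δ) (hΔ : Δ ≠ 1) {h : G} {m : ℤ}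
    (hm : ∀ k ≤ m, k ∈ nonPrefixSet P Δ x h) (n : ℕ) :
    infimum P Δ (x ^ (m - n) * h) ≤ infimum P Δ (x ^ m * h) - n := by
  induction n with
  | zero => simp
  | succ n ih =>
    have := (hG.mem_nonPrefixSet_iff hΔ).1 (hm (m - n) (by lia))
    rw [sub_sub] at this
    push_cast
    lia

/-- The infimum of `x ^ k * h` increases strictly up to some `k` and is constant afterwards: it is
bounded above for `k ≥ 0`, and unbounded below because the supremum of `x ^ n` grows. -/
theorem isGreatest_nonPrefixSet (hG : IsGarsideStructure P Δ) (hinf : infimum P Δ x = 0)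
    (hrigid : IsRightRigid P Δ x) (h : G) :
    IsGreatest (nonPrefixSet P Δ x h) (-lam P Δ x h) := by
  have hΔ := hrigid.delta_ne_one hG
  have hbdd : BddAbove (nonPrefixSet P Δ x h) := by
    have : ∃ k, k ∉ nonPrefixSet P Δ x h := by
      by_contra! hall
      have h₀ := hG.infimum_le_supremum hΔ h
      obtain ⟨N, hN⟩ := Int.eq_ofNat_of_zero_le (sub_nonneg.2 h₀)
      have h₁ := hG.infimum_zpow_sub_le hΔ (m := (N + 1 : ℕ)) (fun k _ => hall k) (N + 1)
      have h₂ := hG.infimum_mul_le_supremum hΔ (x ^ (N + 1)) h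
      rw [hG.infimum_pow hinf hrigid] at h₂
      rw [sub_self, zpow_zero, one_mul, zpow_natCast] at h₁
      push_cast at h₁
      lia
    obtain ⟨k, hk⟩ := this
    refine ⟨k, fun j hj => ?_⟩
    by_contra! hlt
    exact hG.notMem_nonPrefixSet_of_le hinf hrigid hk hlt.le hj
  have hne : (nonPrefixSet P Δ x h).Nonempty := by
    by_contra hempty
    rw [Set.not_nonempty_iff_eq_empty] at hempty
    have h₀ := hG.infimum_le_supremum hΔ h
    obtain ⟨N, hN⟩ := Int.eq_ofNat_of_zero_le (sub_nonneg.2 h₀)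
    have h₁ := hG.infimum_eq_of_notMem hinf hrigid (h := h) (k := -(N + 1 : ℕ) + 1) (j := 0)
      (by simp [hempty]) (by lia)
    have h₂ := hG.infimum_mul_le_supremum hΔ (x ^ (N + 1))⁻¹ h
    rw [hG.infimum_inv hΔ, hG.supremum_pow hinf hrigid] at h₂
    rw [zpow_zero, one_mul, add_sub_cancel_right, zpow_neg, zpow_natCast] at h₁
    have h₃ := hG.one_le_canonicalLength hinf hrigid
    push_cast at h₂
    nlinarith
  rw [lam, neg_neg]
  exact ⟨Int.csSup_mem hne hbdd, fun k hk => le_csSup hbdd hk⟩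

end IsGarsideStructure

/-! ### Preferred paths pass close to the projection -/

theorem IsMorseConstant.nonneg {X : Type*} {d : X → X → ℝ} {γ : ℤ → X} {M : ℝ}
    (hd : ∀ a b, 0 ≤ d a b) (h0 : ∀ a, d a a = 0) (hM : IsMorseConstant d γ 2 0 M) : 0 ≤ M := by
  obtain ⟨k, hk⟩ := hM 0 (fun _ => γ 0) (by intro s hs t ht; simp_all) ⟨0, rfl⟩ ⟨0, rfl⟩ 0 le_rfl
  exact (hd _ _).trans hk

theorem distX_nonneg (u v : Vertex Δ) : 0 ≤ distX P Δ u v :=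
  Nat.cast_nonneg _

theorem distX_self (u : Vertex Δ) : distX P Δ u u = 0 := by
  simp [distX]

namespace IsGarsideStructure

theorem distX_axis (hG : IsGarsideStructure P Δ) (hinf : infimum P Δ x = 0)
    (hrigid : IsRightRigid P Δ x) (i j : ℤ) :
    distX P Δ (vertex Δ (x ^ i)) (vertex Δ (x ^ j)) = |(j : ℝ) - i| * canonicalLength P Δ x := by
  rw [hG.distX_vertex (hrigid.delta_ne_one hG), ← zpow_neg, ← zpow_add,
    hG.canonicalLength_zpow hinf hrigid]
  push_cast
  rw [neg_add_eq_sub]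

/-- If the axis of `x` reaches `z` only through its positive powers, the truncation of `x ^ k * z`
at the length of `x ^ k` is close to `x ^ k`: it is close to some `x ^ j`, and comparing distances
from `1` and from `x ^ j` bounds `|j - k|`. -/
theorem distX_trunc_pow_mul_le (hG : IsGarsideStructure P Δ) (hinf : infimum P Δ x = 0)
    (hrigid : IsRightRigid P Δ x) {M : ℝ} (hM : IsMorseConstant (distX P Δ) (axis Δ x) 2 0 M)
    {z w : G} (hz : ∀ n : ℕ, infimum P Δ (x ^ n * z) = 0) {k : ℕ}
    (hw : IsGreatestCommonPrefix P (x ^ k * z) (Δ ^ (k * canonicalLength P Δ x)) w) :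
    distX P Δ (vertex Δ w) (vertex Δ (x ^ k)) ≤ 2 * M := by
  have hΔ := hrigid.delta_ne_one hG
  have hxP := hG.mem_of_infimum_eq_zero hΔ hinf
  have hzP : z ∈ P := (hG.infimum_nonneg_iff hΔ).1 (by simpa using (hz 0).ge)
  set L := canonicalLength P Δ x with hL
  have hL0 : 0 ≤ L := hG.canonicalLength_nonneg hΔ x
  have hsx := hG.supremum_pow hinf hrigid k
  have hxw : IsPrefix P (x ^ k) w :=
    hw.2.2 _ (isPrefix_mul_self hzP) ((hG.supremum_le_iff hΔ).1 hsx.le)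
  have hsw : supremum P Δ w = k * L :=
    le_antisymm ((hG.supremum_le_iff hΔ).2 hw.2.1) (hsx.ge.trans (hG.supremum_mono hΔ hxw))
  have hwP : w ∈ P := hxw.mem (P.pow_mem hxP k)
  have hiw : infimum P Δ w = 0 :=
    le_antisymm ((hG.infimum_mono hΔ hw.1).trans (hz k).le) ((hG.infimum_nonneg_iff hΔ).2 hwP)
  obtain ⟨j, hj⟩ := hG.exists_distX_le_of_supremum_eq hΔ hM (P.pow_mem hxP k) hxw hiw
    (hsx.trans hsw.symm) ⟨0, by simp [axis]⟩ ⟨k, by simp [axis]⟩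
  rw [axis] at hj
  have h₁ : |(j : ℝ) - k| * L ≤ distX P Δ (vertex Δ w) (vertex Δ (x ^ j)) := by
    rcases le_total j 0 with hj0 | hj0
    · obtain ⟨n, rfl⟩ : ∃ n : ℕ, j = -n := ⟨j.natAbs, by lia⟩
      rw [distX_symm, hG.distX_vertex hΔ, zpow_neg, inv_inv, zpow_natCast]
      have h₂ : infimum P Δ (x ^ n * w) ≤ 0 := by
        rw [← hz (n + k), pow_add, mul_assoc]
        exact hG.infimum_mono hΔ ((isPrefix_mul_left_iff _).2 hw.1)
      have h₃ : (n + k : ℕ) * L ≤ supremum P Δ (x ^ n * w) := by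
        rw [← hG.supremum_pow hinf hrigid, pow_add]
        exact hG.supremum_mono hΔ ((isPrefix_mul_left_iff _).2 hxw)
      have h₄ : ((n + k : ℕ) : ℤ) * L ≤ canonicalLength P Δ (x ^ n * w) := by
        unfold canonicalLength
        lia
      push_cast
      rw [abs_of_nonpos (by linarith [n.cast_nonneg (α := ℝ), k.cast_nonneg (α := ℝ)])]
      have h₅ : (((n + k : ℕ) : ℤ) : ℝ) * L ≤ canonicalLength P Δ (x ^ n * w) := by
        exact_mod_cast h₄
      push_cast at h₅
      linarith
    · have h₂ : distX P Δ (vertex Δ 1) (vertex Δ w) = k * L := by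
        rw [hG.distX_vertex hΔ, inv_one, one_mul, canonicalLength, hsw, hiw]
        push_cast
        ring
      have h₃ := hG.distX_axis hinf hrigid 0 j
      have hj0' : (0 : ℝ) ≤ j := by exact_mod_cast hj0
      rw [zpow_zero, Int.cast_zero, sub_zero, abs_of_nonneg hj0', ← hL] at h₃
      have h₄ := hG.distX_triangle hΔ (vertex Δ 1) (vertex Δ (x ^ j)) (vertex Δ w)
      have h₅ := hG.distX_triangle hΔ (vertex Δ 1) (vertex Δ w) (vertex Δ (x ^ j))
      rw [distX_symm (vertex Δ (x ^ j))] at h₄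
      rcases abs_cases ((j : ℝ) - k) with h | h <;> rw [h.1] <;> linarith
  have h₂ := hG.distX_axis hinf hrigid j k
  rw [Int.cast_natCast, abs_sub_comm, zpow_natCast] at h₂
  have h₃ := hG.distX_triangle hΔ (vertex Δ w) (vertex Δ (x ^ j)) (vertex Δ (x ^ k))
  linarith

/-- If the infimum of `x ^ (-n) * z` decreases at least as fast as `-n`, then any common prefix of
`z` and a power of `x` is short: it is close to some `x ^ j`, where `j` is bounded by the decrease
of the infimum. -/
theorem distX_one_le_of_isPrefix (hG : IsGarsideStructure P Δ) (hinf : infimum P Δ x = 0)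
    (hrigid : IsRightRigid P Δ x) {M : ℝ} (hM : IsMorseConstant (distX P Δ) (axis Δ x) 2 0 M)
    {z b : G} (hz : ∀ n : ℕ, infimum P Δ ((x ^ n)⁻¹ * z) ≤ -n) {k : ℕ} (hb : b ∈ P)
    (hbz : IsPrefix P b z) (hbx : IsPrefix P b (x ^ k)) :
    distX P Δ (vertex Δ b) (vertex Δ 1) ≤ (canonicalLength P Δ x + 1) * M := by
  have hΔ := hrigid.delta_ne_one hG
  have hL1 := hG.one_le_canonicalLength hinf hrigid
  set L := canonicalLength P Δ x with hL
  have hL1' : (1 : ℝ) ≤ L := by exact_mod_cast hL1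
  have hM0 := hM.nonneg distX_nonneg distX_self
  obtain ⟨j, hj⟩ := hG.exists_distX_le_of_isPrefix hΔ hM hb hbx (hG.infimum_pow hinf hrigid k)
    ⟨0, by simp [axis]⟩ ⟨k, by simp [axis]⟩
  rw [axis] at hj
  rcases le_total j 0 with hj0 | hj0
  · obtain ⟨n, rfl⟩ : ∃ n : ℕ, j = -n := ⟨j.natAbs, by lia⟩
    have h₁ : distX P Δ (vertex Δ b) (vertex Δ 1) ≤
        distX P Δ (vertex Δ b) (vertex Δ (x ^ (-n : ℤ))) := by
      rw [distX_symm, distX_symm (vertex Δ b), hG.distX_vertex hΔ, hG.distX_vertex hΔ, zpow_neg,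
        inv_inv, inv_one, one_mul, zpow_natCast]
      have h₂ : infimum P Δ (x ^ n * b) ≤ 0 := by
        rw [← hG.infimum_pow hinf hrigid (n + k), pow_add]
        exact hG.infimum_mono hΔ ((isPrefix_mul_left_iff _).2 hbx)
      have h₃ := hG.supremum_mul_le hΔ (x ^ n)⁻¹ (x ^ n * b)
      rw [inv_mul_cancel_left, hG.supremum_inv hΔ, hG.infimum_pow hinf hrigid] at h₃
      have h₄ := (hG.infimum_nonneg_iff hΔ).2 hb
      have h₅ : canonicalLength P Δ b ≤ canonicalLength P Δ (x ^ n * b) := by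
        unfold canonicalLength
        lia
      exact_mod_cast h₅
    nlinarith
  · obtain ⟨n, rfl⟩ := Int.eq_ofNat_of_zero_le hj0
    have h₁ : (n : ℝ) ≤ M := by
      refine le_trans ?_ hj
      rw [distX_symm, hG.distX_vertex hΔ, zpow_natCast]
      have h₂ : infimum P Δ ((x ^ n)⁻¹ * b) ≤ -n :=
        (hG.infimum_mono hΔ ((isPrefix_mul_left_iff _).2 hbz)).trans (hz n)
      have h₃ : 0 ≤ supremum P Δ ((x ^ n)⁻¹ * b) := by
        have h₄ := hG.infimum_mul_le hΔ b (b⁻¹ * x ^ n)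
        rw [mul_inv_cancel_left, hG.infimum_pow hinf hrigid] at h₄
        have h₅ := (hG.infimum_nonneg_iff hΔ).2 hb
        have h₆ := hG.supremum_inv hΔ (b⁻¹ * x ^ n)
        rw [mul_inv_rev, inv_inv] at h₆
        lia
      have h₄ : (n : ℤ) ≤ canonicalLength P Δ ((x ^ n)⁻¹ * b) := by
        unfold canonicalLength
        lia
      exact_mod_cast h₄
    have h₂ := hG.distX_axis hinf hrigid n 0
    rw [zpow_zero, Int.cast_zero, zero_sub, abs_neg, Int.cast_natCast,
      abs_of_nonneg n.cast_nonneg, ← hL] at h₂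
    have h₃ := hG.distX_triangle hΔ (vertex Δ b) (vertex Δ (x ^ (n : ℤ))) (vertex Δ 1)
    have h₄ : (n : ℝ) * L ≤ M * L := by gcongr
    have hj' : distX P Δ (vertex Δ b) (vertex Δ (x ^ (n : ℤ))) ≤ M := hj
    linarith

theorem passesNearProj (hG : IsGarsideStructure P Δ) (hinf : infimum P Δ x = 0)
    (hrigid : IsRightRigid P Δ x) {M : ℝ} (hM : IsMorseConstant (distX P Δ) (axis Δ x) 2 0 M) :
    PassesNearProj P Δ x (((canonicalLength P Δ x : ℝ) + 1) * M) := by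
  have hΔ := hrigid.delta_ne_one hG
  intro h i
  have hmax := hG.isGreatest_nonPrefixSet hinf hrigid h
  set m := -lam P Δ x h with hm
  have hproj : proj P Δ x h = vertex Δ (x ^ (-m)) := by rw [proj, axis, hm, neg_neg]
  set r := infimum P Δ (x ^ m * h) with hr
  set z := x ^ m * h * Δ ^ (-r) with hz
  have hL1 := hG.one_le_canonicalLength hinf hrigid
  have hz₁ : ∀ n : ℕ, infimum P Δ (x ^ n * z) = 0 := by
    intro n
    have hnot : m + 1 ∉ nonPrefixSet P Δ x h := fun hmem => by
      have := hmax.2 hmem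
      lia
    have := hG.infimum_eq_of_notMem hinf hrigid hnot (j := n + m) (by lia)
    rw [add_sub_cancel_right, ← hr, zpow_add, zpow_natCast] at this
    rw [hz, ← mul_assoc, ← mul_assoc, hG.infimum_mul_zpow hΔ, this, add_neg_cancel]
  have hdown : ∀ n : ℕ, infimum P Δ (x ^ (m - n) * h) ≤ r - n := by
    refine hG.infimum_zpow_sub_le hΔ fun k hk => ?_
    by_contra hnot
    exact hG.notMem_nonPrefixSet_of_le hinf hrigid hnot hk hmax.1
  rw [hproj]
  rcases le_total i (-m) with him | him
  · -- here `rep (x ^ (-i) * h) = x ^ k * z` with `k = -m - i ≥ 0`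
    obtain ⟨k, hk⟩ := Int.eq_ofNat_of_zero_le (sub_nonneg.2 him)
    have hxk : (x ^ i)⁻¹ * h = x ^ k * (x ^ m * h) := by
      rw [← mul_assoc, ← zpow_natCast, ← zpow_add, ← zpow_neg]
      congr 2
      lia
    have hrep : rep P Δ ((x ^ i)⁻¹ * h) = x ^ k * z := by
      have h₁ := hz₁ k
      rw [hz, ← mul_assoc, hG.infimum_mul_zpow hΔ] at h₁
      have h₂ : infimum P Δ (x ^ k * (x ^ m * h)) = r := by lia
      rw [rep, hxk, h₂, hz, mul_assoc (x ^ k)]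
    obtain ⟨w, hw⟩ := hG.exists_prefix_inf (x ^ k * z) (Δ ^ (k * canonicalLength P Δ x))
    refine ⟨_, hG.vertex_mul_mem_preferredPath hΔ (n := k * canonicalLength P Δ x)
      (by positivity) (hrep ▸ hw), ?_⟩
    have hxm : x ^ (-m) = x ^ i * x ^ k := by
      rw [← zpow_natCast, ← zpow_add]
      congr 1
      lia
    rw [hxm, hG.distX_mul_left hΔ]
    refine (hG.distX_trunc_pow_mul_le hinf hrigid hM hz₁ hw).trans ?_
    have hM0 := hM.nonneg distX_nonneg distX_self
    have hL1' : (1 : ℝ) ≤ canonicalLength P Δ x := by exact_mod_cast hL1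
    gcongr
    linarith
  · -- here `rep (x ^ (-i) * h) = x ^ (-k) * z * Δ ^ e` with `k = i + m ≥ 0` and `e ≥ k`,
    -- whose truncation at `e` comes from the greatest common prefix of `x ^ k` and `z`
    obtain ⟨k, hk⟩ := Int.eq_ofNat_of_zero_le (sub_nonneg.2 him)
    have hxk : (x ^ i)⁻¹ * h = x ^ (m - k) * h := by
      rw [← zpow_neg]
      congr 2
      lia
    set e := r - infimum P Δ (x ^ (m - k) * h) with he
    have he0 : 0 ≤ e := by
      have := hdown k
      lia
    have hrep : rep P Δ ((x ^ i)⁻¹ * h) = (x ^ k)⁻¹ * z * Δ ^ e := by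
      rw [rep, hxk, hz, he]
      group
    obtain ⟨b, hb⟩ := hG.exists_prefix_inf (x ^ k) z
    have hbP : b ∈ P := by
      refine isPrefix_one_iff.1 (hb.2.2 1 (isPrefix_one_iff.2 ?_) (isPrefix_one_iff.2 ?_))
      · exact P.pow_mem (hG.mem_of_infimum_eq_zero hΔ hinf) k
      · exact (hG.infimum_nonneg_iff hΔ).1 (by simpa using (hz₁ 0).ge)
    have hw : IsGreatestCommonPrefix P (rep P Δ ((x ^ i)⁻¹ * h)) (Δ ^ e)
        ((x ^ k)⁻¹ * b * Δ ^ e) := by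
      have hΔe : Δ ^ e = (x ^ k)⁻¹ * x ^ k * Δ ^ e := by group
      rw [hrep]
      refine ⟨?_, ?_, fun c h₁ h₂ => ?_⟩
      · rw [hG.isPrefix_mul_zpow_iff, isPrefix_mul_left_iff]
        exact hb.2.1
      · conv_rhs => rw [hΔe]
        rw [hG.isPrefix_mul_zpow_iff, isPrefix_mul_left_iff]
        exact hb.1
      · obtain ⟨c, rfl⟩ : ∃ c', c = (x ^ k)⁻¹ * c' * Δ ^ e :=
          ⟨x ^ k * c * Δ ^ (-e), by group⟩
        rw [hG.isPrefix_mul_zpow_iff, isPrefix_mul_left_iff] at h₁ ⊢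
        conv_rhs at h₂ => rw [hΔe]
        rw [hG.isPrefix_mul_zpow_iff, isPrefix_mul_left_iff] at h₂
        exact hb.2.2 _ h₂ h₁
    refine ⟨_, hG.vertex_mul_mem_preferredPath hΔ he0 hw, ?_⟩
    have hxm : x ^ i * ((x ^ k)⁻¹ * b * Δ ^ e) = x ^ (-m) * b * Δ ^ e := by
      rw [← mul_assoc, ← mul_assoc, ← zpow_natCast, ← zpow_neg, ← zpow_add]
      congr 3
      lia
    rw [hxm, vertex_mul_zpow]
    conv_lhs => rw [← mul_one (x ^ (-m)), mul_assoc, one_mul]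
    rw [hG.distX_mul_left hΔ]
    refine hG.distX_one_le_of_isPrefix hinf hrigid hM (fun n => ?_) hbP hb.2.1 hb.1
    have := hdown n
    rw [hz, ← mul_assoc, ← mul_assoc, hG.infimum_mul_zpow hΔ, ← zpow_natCast, ← zpow_neg,
      ← zpow_add, neg_add_eq_sub]
    lia

/-- Since preferred paths are geodesics, passing near `π(h)` forces every closest point of the axis
to be near `π(h)`. -/
theorem distX_proj_le (hG : IsGarsideStructure P Δ) (hΔ : Δ ≠ 1) {D : ℝ}
    (hD : PassesNearProj P Δ x D) {h : G} {k : ℤ}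
    (hk : ∀ i : ℤ, distX P Δ (vertex Δ h) (axis Δ x k) ≤ distX P Δ (vertex Δ h) (axis Δ x i)) :
    distX P Δ (proj P Δ x h) (axis Δ x k) ≤ 2 * D := by
  obtain ⟨v, hv, hvD⟩ := hD h k
  have h₁ := hG.distX_add_distX_le_of_mem_preferredPath hΔ hv
  have h₂ := hk (lam P Δ x h)
  change _ ≤ distX P Δ (vertex Δ h) (proj P Δ x h) at h₂
  have h₃ := hG.distX_triangle hΔ (vertex Δ h) v (proj P Δ x h)
  have h₄ := hG.distX_triangle hΔ (axis Δ x k) v (proj P Δ x h)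
  rw [distX_symm (vertex Δ h) v] at h₃
  rw [distX_symm (vertex Δ h) (axis Δ x k)] at h₂
  rw [distX_symm (proj P Δ x h)]
  unfold axis at *
  linarith

end IsGarsideStructure

end Garside

theorem propositionP {G : Type*} [Group G] (P : Submonoid G) (Δ : G)
    (hG : Garside.IsGarsideStructure P Δ) (hfin : (Garside.simples P Δ).Finite)
    (x : G) (hinf : Garside.infimum P Δ x = 0) (hrigid : Garside.IsRightRigid P Δ x)
    (hmorse : Garside.IsMorse P Δ x) :
    -- the maximum defining the projection exists
    (∀ h : G, IsGreatest (Garside.nonPrefixSet P Δ x h) (-Garside.lam P Δ x h)) ∧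
    -- preferred geodesics pass uniformly close to the projection
    (∃ D : ℕ, Garside.PassesNearProj P Δ x D) ∧
    -- the constant can be taken to be `(ℓ + 1) M` for any Morse constant `M` for `(2, 0)`
    (∀ M : ℝ, Garside.IsMorseConstant (Garside.distX P Δ) (Garside.axis Δ x) 2 0 M →
      Garside.PassesNearProj P Δ x (((Garside.canonicalLength P Δ x : ℝ) + 1) * M)) ∧
    -- the projection is within `2 D` of any closest-point projection
    (∀ D : ℝ, Garside.PassesNearProj P Δ x D → ∀ (h : G) (k : ℤ),
      (∀ i : ℤ, Garside.distX P Δ (Garside.vertex Δ h) (Garside.axis Δ x k) ≤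
        Garside.distX P Δ (Garside.vertex Δ h) (Garside.axis Δ x i)) →
      Garside.distX P Δ (Garside.proj P Δ x h) (Garside.axis Δ x k) ≤ 2 * D) := by
  refine ⟨hG.isGreatest_nonPrefixSet hinf hrigid, ?_, fun M hM => hG.passesNearProj hinf hrigid hM,
    fun D hD h k hk => hG.distX_proj_le (hrigid.delta_ne_one hG) hD hk⟩
  obtain ⟨M, hM⟩ := hmorse.2 2 0 (by norm_num) le_rfl
  obtain ⟨D, hD⟩ := exists_nat_ge (((Garside.canonicalLength P Δ x : ℝ) + 1) * M)
  refine ⟨D, fun h i => ?_⟩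
  obtain ⟨v, hv, hvD⟩ := hG.passesNearProj hinf hrigid hM h i
  exact ⟨v, hv, hvD.trans hD⟩
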